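/- Let $M=(\mathcal M,g)$ be a time-oriented spacetime: a smooth connected manifold of dimension $D\ge 2$ with a smooth Lorentzian metric $g$ of signature $(+,-,\dots,-)$. Let $\mathcal U_M=\bigoplus_{n\ge 0}C^\infty_0(M^{n})$ be the Borchers--Uhlmann $*$-algebra, with product $(fg)(x_{n+m},\dots,x_1)=f(x_{n+m},\dots,x_{n+1})\,g(x_n,\dots,x_1)$ for $f\in C_0^\infty(M^m)$, $g\in C_0^\infty(M^n)$, with involution $f^*(x_n,\dots,x_1)=\overline{f(x_1,\dots,x_n)}$, unit $I$, and the strict inductive limit topology of the subspaces $\bigoplus_{n\le N}C_0^\infty(K_N^{n})$, $K_N$ an increasing compact exhaustion of $M$. A state $\omega$ is a normalised, positive, continuous linear functional on $\mathcal U_M$; its $n$-point distribution $\omega_n$ is its restriction to $C_0^\infty(M^{n})$, and $$\omega_{2\pm}(x_2,x_1)=\tfrac12\bigl(\omega_2(x_2,x_1)\pm\omega_2(x_1,x_2)\bigr).$$ Let $\Gamma_2\subset T^*M^{2}\setminus\mathcal Z$ ($\mathcal Z$ the zero section) be the set of points $(x_2,k_2;x_1,k_1)$ for which there are finitely many piecewise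 smooth curves $\gamma_r$ in $M$ between $x_1$ and $x_2$, and along each $\gamma_r$ a covariantly constant field $\xi_r$ of future pointing causal covectors, such that $k_1=\sum_r\xi_r(x_1)$ and $k_2=-\sum_r\xi_r(x_2)$. (Here $\xi_r(x_1)$, $\xi_r(x_2)$ are the values at the two end points of $\gamma_r$.) The state $\omega$ is a generalised Hadamard state if $WF(\omega_2)\subset\Gamma_2$. For a distribution $E$ on $M^{2}$, $\omega$ is a generalised free field state with commutator $E$ if $\omega$ descends to a state on $\mathcal U_M/J$, where $J$ is the $*$-ideal generated by all $f\otimes h-h\otimes f-iE(f,h)I$ with $f,h\in C_0^\infty(M)$. Proposition. Let $\omega$ be a generalised Hadamard state. Then: 1. for each choice of sign, $(x_2,k_2;x_1,k_1)\in WF(\omega_{2\pm})$ iff $(x_1,k_1;x_2,k_2)\in WF(\omega_{2\pm})$ iff $(x_2,-k_2;x_1,-k_1)\in WF(\omega_{2\pm})$; 2. $WF(\omega_{2+})=WF(\omega_{2-})\subset\Gamma_2\cup-\Gamma_2$; 3. $WF(\omega_2)=WF(\omega_{2-})\cap\Gamma_2$; 4. if $\omega$ is moreover a generalised free field state with commutator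 $E$, then $E=-2i\,\omega_{2-}$, $WF(E)\subset\Gamma_2\cup-\Gamma_2$ and $WF(\omega_2)=WF(E)\cap\Gamma_2$. -/

import Mathlib

open Set Topology Manifold
open scoped ContDiff

noncomputable section

namespace QFT

universe u

/-- The model space of a `d`-dimensional manifold. -/
abbrev Coord (d : ℕ) := EuclideanSpace ℝ (Fin d)

/-- The model with corners of the product manifold `M^n = (Fin n → M)`. -/
abbrev powModel (d n : ℕ) :
    ModelWithCorners ℝ (Fin n → Coord d) (ModelPi fun _ : Fin n => Coord d) :=
  ModelWithCorners.pi fun _ : Fin n => 𝓡 d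

theorem contMDiffAt_mul_complex {E H N : Type*} [NormedAddCommGroup E] [NormedSpace ℝ E]
    [TopologicalSpace H] {I : ModelWithCorners ℝ E H} [TopologicalSpace N] [ChartedSpace H N]
    {f g : N → ℂ} {x : N} (hf : ContMDiffAt I 𝓘(ℝ, ℂ) ∞ f x) (hg : ContMDiffAt I 𝓘(ℝ, ℂ) ∞ g x) :
    ContMDiffAt I 𝓘(ℝ, ℂ) ∞ (fun x => f x * g x) x :=
  ContDiff.comp_contMDiffAt (g := fun p : ℂ × ℂ => p.1 * p.2)
    (contDiff_fst.mul contDiff_snd) (hf.prodMk_space hg)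

section TestFunctions

variable (d : ℕ) (M : Type u) [TopologicalSpace M] [ChartedSpace (Coord d) M]

/-- Complex-valued smooth functions with compact support on `M^n`. -/
def testSubmodule (n : ℕ) : Submodule ℂ ((Fin n → M) → ℂ) where
  carrier := {f | ContMDiff (powModel d n) 𝓘(ℝ, ℂ) ∞ f ∧ HasCompactSupport f}
  add_mem' hf hg := ⟨hf.1.add hg.1, hf.2.add hg.2⟩
  zero_mem' := ⟨contMDiff_const, HasCompactSupport.zero⟩
  smul_mem' c _ hf := ⟨fun x => contMDiffAt_mul_complex contMDiffAt_const (hf.1 x), hf.2.mul_left (f := fun _ => c)⟩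

/-- The space `C^∞_0(M^n)`. Points of `M^n` are tuples listed as `(x_n, …, x_1)`, i.e. position `0`
holds `x_n`. -/
def TestFn (n : ℕ) : Type u := ↥(testSubmodule d M n)

variable {d M} {n m k : ℕ}

instance : AddCommGroup (TestFn d M n) := inferInstanceAs (AddCommGroup ↥(testSubmodule d M n))
instance : Module ℂ (TestFn d M n) := inferInstanceAs (Module ℂ ↥(testSubmodule d M n))
instance : Module ℝ (TestFn d M n) := inferInstanceAs (Module ℝ ↥(testSubmodule d M n))
instance : IsScalarTower ℝ ℂ (TestFn d M n) :=
  inferInstanceAs (IsScalarTower ℝ ℂ ↥(testSubmodule d M n))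

instance : FunLike (TestFn d M n) (Fin n → M) ℂ where
  coe f := f.1
  coe_injective _ _ h := Subtype.ext h

def TestFn.mk (f : (Fin n → M) → ℂ) (hf : ContMDiff (powModel d n) 𝓘(ℝ, ℂ) ∞ f)
    (hc : HasCompactSupport f) : TestFn d M n := ⟨f, hf, hc⟩

@[ext] theorem TestFn.ext {f g : TestFn d M n} (h : ∀ x, f x = g x) : f = g := DFunLike.ext _ _ h
@[simp] theorem TestFn.mk_apply (f : (Fin n → M) → ℂ) (hf hc) (x : Fin n → M) :
    (TestFn.mk f hf hc : TestFn d M n) x = f x := rfl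
@[simp] theorem TestFn.add_apply (f g : TestFn d M n) (x : Fin n → M) : (f + g) x = f x + g x := rfl
@[simp] theorem TestFn.zero_apply (x : Fin n → M) : (0 : TestFn d M n) x = 0 := rfl
@[simp] theorem TestFn.neg_apply (f : TestFn d M n) (x : Fin n → M) : (-f) x = -f x := rfl
@[simp] theorem TestFn.smul_apply (c : ℂ) (f : TestFn d M n) (x : Fin n → M) :
    (c • f) x = c * f x := rfl
theorem TestFn.contMDiff (f : TestFn d M n) : ContMDiff (powModel d n) 𝓘(ℝ, ℂ) ∞ f := f.2.1
theorem TestFn.hasCompactSupport (f : TestFn d M n) : HasCompactSupport f := f.2.2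

theorem contMDiff_eval (i : Fin n) :
    ContMDiff (powModel d n) (𝓡 d) ∞ (fun x : Fin n → M => x i) := by
  intro x
  rw [contMDiffAt_iff]
  refine ⟨(continuous_apply i).continuousAt, ?_⟩
  have h : ContDiffWithinAt ℝ ∞ (fun y : Fin n → Coord d => y i) (range (powModel d n))
      (extChartAt (powModel d n) x x) := (contDiff_apply ℝ (Coord d) i).contDiffWithinAt
  refine h.congr_of_eventuallyEq ?_ ?_
  · filter_upwards [extChartAt_target_mem_nhdsWithin (I := powModel d n) x] with y hy
    have hy' : y i ∈ (extChartAt (𝓡 d) (x i)).target := by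
      have := hy
      simp only [extChartAt, OpenPartialHomeomorph.extend, piChartedSpace_chartAt,
        PartialEquiv.trans_target] at this
      obtain ⟨h1, h2⟩ := this
      simpa [extChartAt] using (show y i ∈ (chartAt (Coord d) (x i)).target from h2 i (mem_univ i))
    exact (extChartAt (𝓡 d) (x i)).right_inv hy'
  · exact (extChartAt (𝓡 d) (x i)).right_inv (mem_extChartAt_target (I := 𝓡 d) (x i))

theorem contMDiff_reindex (σ : Fin m → Fin n) :
    ContMDiff (powModel d n) (powModel d m) ∞ (fun x : Fin n → M => x ∘ σ) := by
  intro x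
  rw [contMDiffAt_iff_target]
  refine ⟨(continuous_pi fun i => continuous_apply (σ i)).continuousAt, ?_⟩
  refine contMDiffAt_pi_space.2 fun i => ?_
  have h := contMDiff_eval (d := d) (σ i) x
  exact (contMDiffAt_iff_target.1 h).2

/-- `(f ⊗ g)(x_{n+m}, …, x_1) = f(x_{n+m}, …, x_{m+1}) g(x_m, …, x_1)`. -/
def TestFn.tensor [T2Space M] (f : TestFn d M n) (g : TestFn d M m) : TestFn d M (n + m) :=
  .mk (fun x => f (x ∘ Fin.castAdd m) * g (x ∘ Fin.natAdd n))
    (fun x => contMDiffAt_mul_complex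
      (f.contMDiff.comp (contMDiff_reindex (Fin.castAdd m)) x)
      (g.contMDiff.comp (contMDiff_reindex (Fin.natAdd n)) x))
    (by
      refine HasCompactSupport.intro
        ((f.hasCompactSupport.isCompact.prod g.hasCompactSupport.isCompact).image
          (Fin.continuous_append n m)) fun x hx => ?_
      by_contra h
      refine hx ⟨(x ∘ Fin.castAdd m, x ∘ Fin.natAdd n), ⟨?_, ?_⟩, ?_⟩
      · exact subset_tsupport _ (left_ne_zero_of_mul h)
      · exact subset_tsupport _ (right_ne_zero_of_mul h)
      · exact Fin.append_castAdd_natAdd)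

/-- Permutation of the arguments of a test function. -/
def TestFn.permute (σ : Equiv.Perm (Fin n)) : TestFn d M n →ₗ[ℂ] TestFn d M n where
  toFun f := .mk (fun x => f (x ∘ σ)) (f.contMDiff.comp (contMDiff_reindex σ))
    (f.hasCompactSupport.comp_homeomorph (Homeomorph.piCongrLeft (Y := fun _ => M) σ).symm)
  map_add' _ _ := rfl
  map_smul' _ _ := rfl

/-- Complex conjugation of test functions. -/
def TestFn.conj (f : TestFn d M n) : TestFn d M n :=
  .mk (fun x => starRingEnd ℂ (f x))
    (Complex.conjCLE.contDiff.contMDiff.comp f.contMDiff)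
    (f.hasCompactSupport.comp_left (g := starRingEnd ℂ) (map_zero _))


end TestFunctions

section InductiveLimit

variable {V : Type*} [AddCommGroup V] [Module ℂ V] [Module ℝ V]
  {ι : Type*} {W : ι → Type*} (tW : ∀ i, TopologicalSpace (W i)) (j : ∀ i, W i → V)

/-- The locally convex inductive limit topology: the finest locally convex vector space topology for
which all the maps `j i` are continuous. -/
abbrev inductiveTopology : TopologicalSpace V :=
  sInf {t | (∀ i, @Continuous _ _ (tW i) t (j i)) ∧ @IsTopologicalAddGroup V t _ ∧
    @ContinuousSMul ℂ V _ _ t ∧ @LocallyConvexSpace ℝ V _ _ _ _ t}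

theorem inductiveTopology_addGroup : @IsTopologicalAddGroup V (inductiveTopology tW j) _ :=
  topologicalAddGroup_sInf fun _ h => h.2.1

theorem inductiveTopology_smul : @ContinuousSMul ℂ V _ _ (inductiveTopology tW j) :=
  continuousSMul_sInf fun _ h => h.2.2.1

theorem inductiveTopology_convex : @LocallyConvexSpace ℝ V _ _ _ _ (inductiveTopology tW j) :=
  .sInf fun _ h => h.2.2.2

theorem continuous_to_inductiveTopology (i : ι) :
    @Continuous _ _ (tW i) (inductiveTopology tW j) (j i) :=
  continuous_sInf_rng.2 fun _ h => h.1 i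

theorem continuous_from_inductiveTopology [IsScalarTower ℝ ℂ V] {F : Type*} [AddCommGroup F] [Module ℂ F] [Module ℝ F]
    [IsScalarTower ℝ ℂ F] [tF : TopologicalSpace F] [IsTopologicalAddGroup F] [ContinuousSMul ℂ F]
    [LocallyConvexSpace ℝ F] (f : V →ₗ[ℂ] F) (h : ∀ i, @Continuous _ _ (tW i) _ (f ∘ j i)) :
    @Continuous _ _ (inductiveTopology tW j) _ f := by
  refine continuous_iff_le_induced.2 (sInf_le ⟨fun i => ?_, ?_, ?_, ?_⟩)
  · exact continuous_induced_rng.2 (h i)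
  · exact topologicalAddGroup_induced f
  · exact continuousSMul_induced f
  · exact LocallyConvexSpace.induced (f.restrictScalars ℝ)

end InductiveLimit

section TestTopology

variable (d : ℕ) (M : Type u) [TopologicalSpace M] [ChartedSpace (Coord d) M] (n : ℕ)

/-- Uniform convergence of all derivatives on compact subsets of coordinate patches. -/
@[reducible] def smoothTopology : TopologicalSpace (TestFn d M n) :=
  ⨅ (x : Fin n → M) (k : ℕ), .induced
    (fun f => UniformOnFun.ofFun {L | IsCompact L ∧ L ⊆ (extChartAt (powModel d n) x).target}
      (iteratedFDeriv ℝ k (f ∘ (extChartAt (powModel d n) x).symm))) inferInstance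

variable {M n} in
/-- The subspace `C^∞_0(K)` of test functions supported in `K`. -/
def TestFn.supportedIn (K : Set (Fin n → M)) : Set (TestFn d M n) := {f | tsupport f ⊆ K}

/-- The test-function topology on `C^∞_0(M^n)`: the inductive limit of the spaces `C^∞_0(K)`, `K`
compact. -/
instance : TopologicalSpace (TestFn d M n) :=
  inductiveTopology (ι := {K : Set (Fin n → M) // IsCompact K})
    (W := fun K => TestFn.supportedIn d K.1)
    (fun _ => .induced Subtype.val (smoothTopology d M n)) (fun _ f => f.1)

instance : IsTopologicalAddGroup (TestFn d M n) :=
  topologicalAddGroup_sInf fun _ h => h.2.1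
instance : ContinuousSMul ℂ (TestFn d M n) :=
  continuousSMul_sInf fun _ h => h.2.2.1
instance : LocallyConvexSpace ℝ (TestFn d M n) :=
  .sInf fun _ h => h.2.2.2

variable {d M n}

theorem continuous_permute_smooth (σ : Equiv.Perm (Fin n)) :
    @Continuous _ _ (smoothTopology d M n) (smoothTopology d M n) (TestFn.permute σ : TestFn d M n → TestFn d M n) := by
  refine continuous_iInf_rng.2 fun x => continuous_iInf_rng.2 fun k => continuous_induced_rng.2 ?_
  let P : (Fin n → Coord d) ≃L[ℝ] (Fin n → Coord d) :=
    (ContinuousLinearEquiv.piCongrLeft ℝ (fun _ => Coord d) σ).symm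
  have hP : ∀ y, P y = y ∘ σ := fun y => rfl
  let 𝔖 := fun x : Fin n → M => {L | IsCompact L ∧ L ⊆ (extChartAt (powModel d n) x).target}
  have key : ∀ f : TestFn d M n,
      iteratedFDeriv ℝ k (TestFn.permute σ f ∘ (extChartAt (powModel d n) x).symm) =
      (fun A => ContinuousMultilinearMap.compContinuousLinearMapL
        (fun _ => (P : (Fin n → Coord d) →L[ℝ] (Fin n → Coord d))) A) ∘
      (iteratedFDeriv ℝ k (f ∘ (extChartAt (powModel d n) (x ∘ σ)).symm) ∘ P) := by
    intro f
    have h1 : TestFn.permute σ f ∘ (extChartAt (powModel d n) x).symm =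
      (f ∘ (extChartAt (powModel d n) (x ∘ σ)).symm) ∘ P := rfl
    ext1 y
    rw [h1, ← iteratedFDerivWithin_univ, ← iteratedFDerivWithin_univ]
    have := P.iteratedFDerivWithin_comp_right (f ∘ (extChartAt (powModel d n) (x ∘ σ)).symm)
      uniqueDiffOn_univ (x := y) (mem_univ _) k
    rw [preimage_univ] at this
    exact this
  have hmaps : MapsTo (P '' ·) (𝔖 x) (𝔖 (x ∘ σ)) := by
    rintro L ⟨hL, hLx⟩
    refine ⟨hL.image P.continuous, ?_⟩
    rintro _ ⟨y, hy, rfl⟩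
    obtain ⟨h1, h2⟩ := hLx hy
    exact ⟨by simp [powModel, ModelWithCorners.pi], fun i _ => h2 (σ i) (mem_univ _)⟩
  have hc := (UniformOnFun.postcomp_uniformContinuous (𝔖 := 𝔖 x)
      (ContinuousMultilinearMap.compContinuousLinearMapL (𝕜 := ℝ) (F := ℂ)
        (fun _ : Fin k => (P : (Fin n → Coord d) →L[ℝ] (Fin n → Coord d)))).uniformContinuous).comp
    (UniformOnFun.precomp_uniformContinuous (β := (Fin n → Coord d) [×k]→L[ℝ] ℂ) hmaps)
  have h0 : @Continuous _ _ (smoothTopology d M n) _ (fun f : TestFn d M n =>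
      UniformOnFun.ofFun (𝔖 (x ∘ σ))
        (iteratedFDeriv ℝ k (f ∘ (extChartAt (powModel d n) (x ∘ σ)).symm))) :=
    continuous_iInf_dom (i := x ∘ σ) (continuous_iInf_dom (i := k) continuous_induced_dom)
  refine @Continuous.congr _ _ (smoothTopology d M n) _ _ _
    (@Continuous.comp _ _ _ (smoothTopology d M n) _ _ _ _ hc.continuous h0) fun f => ?_
  simp only [Function.comp_apply, key]
  rfl

theorem tsupport_permute (σ : Equiv.Perm (Fin n)) (f : TestFn d M n) :
    tsupport (TestFn.permute σ f) = (fun x => x ∘ σ) ⁻¹' tsupport f :=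
  tsupport_comp_eq_preimage f (Homeomorph.piCongrLeft (Y := fun _ => M) σ).symm

theorem TestFn.continuous_of_supportedIn {F : Type*} [AddCommGroup F] [Module ℂ F] [Module ℝ F]
    [IsScalarTower ℝ ℂ F] [TopologicalSpace F] [IsTopologicalAddGroup F] [ContinuousSMul ℂ F]
    [LocallyConvexSpace ℝ F] (f : TestFn d M n →ₗ[ℂ] F)
    (h : ∀ K : Set (Fin n → M), IsCompact K →
      @Continuous (TestFn.supportedIn d K) F (.induced Subtype.val (smoothTopology d M n)) _
        fun g => f g.1) : Continuous f :=
  continuous_from_inductiveTopology (ι := {K : Set (Fin n → M) // IsCompact K})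
    (W := fun K => TestFn.supportedIn d K.1)
    (fun _ => .induced Subtype.val (smoothTopology d M n)) (fun _ f => f.1) f fun K => h K.1 K.2

theorem TestFn.continuous_supportedIn_val {K : Set (Fin n → M)} (hK : IsCompact K) :
    @Continuous (TestFn.supportedIn d K) (TestFn d M n)
      (.induced Subtype.val (smoothTopology d M n)) _ Subtype.val :=
  continuous_to_inductiveTopology (ι := {K : Set (Fin n → M) // IsCompact K})
    (W := fun K => TestFn.supportedIn d K.1)
    (fun _ => .induced Subtype.val (smoothTopology d M n)) (fun _ f => f.1) ⟨K, hK⟩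

/-- Permutation of the arguments, as a continuous linear map. -/
def TestFn.permuteL (σ : Equiv.Perm (Fin n)) : TestFn d M n →L[ℂ] TestFn d M n where
  toLinearMap := TestFn.permute σ
  cont := by
    refine TestFn.continuous_of_supportedIn (TestFn.permute σ) fun K hK => ?_
    let H := (Homeomorph.piCongrLeft (Y := fun _ => M) σ).symm
    let r : TestFn.supportedIn d K → TestFn.supportedIn d (H ⁻¹' K) := fun f =>
      ⟨TestFn.permute σ f.1, by
        change tsupport (TestFn.permute σ f.1) ⊆ _
        rw [tsupport_permute]; exact preimage_mono f.2⟩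
    have hr : @Continuous _ _ (.induced Subtype.val (smoothTopology d M n))
        (.induced Subtype.val (smoothTopology d M n)) r := by
      refine continuous_induced_rng.2 ?_
      exact @Continuous.comp _ _ _ (_) (smoothTopology d M n) (smoothTopology d M n) _ _
        (continuous_permute_smooth σ) continuous_induced_dom
    have hv : @Continuous (TestFn.supportedIn d (H ⁻¹' K)) (TestFn d M n)
        (.induced Subtype.val (smoothTopology d M n)) _ Subtype.val :=
      TestFn.continuous_supportedIn_val (H.isCompact_preimage.2 hK)
    exact @Continuous.comp _ _ _ (_) (.induced Subtype.val (smoothTopology d M n)) _ r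
      Subtype.val hv hr

end TestTopology

section Algebra

variable (d : ℕ) (M : Type u) [TopologicalSpace M] [ChartedSpace (Coord d) M]

/-- The Borchers-Uhlmann algebra `⨁_n C^∞_0(M^n)`. -/
abbrev BorchersUhlmann : Type u := DirectSum ℕ fun n => TestFn d M n

variable {d M} {n m : ℕ}

theorem TestFn.gradedMonoid_ext (h : n = m) (f : TestFn d M n) (g : TestFn d M m)
    (hfg : ∀ x : Fin m → M, f (x ∘ Fin.cast h) = g x) :
    GradedMonoid.mk (A := fun n => TestFn d M n) n f = GradedMonoid.mk m g := by
  subst h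
  congr
  ext x
  exact hfg x

/-- `f^*(x_n, …, x_1) = conj (f (x_1, …, x_n))`. -/
def TestFn.adjoint : TestFn d M n →+ TestFn d M n where
  toFun f := (TestFn.permute Fin.revPerm f).conj
  map_zero' := TestFn.ext fun _ => map_zero (starRingEnd ℂ)
  map_add' _ _ := TestFn.ext fun _ => map_add (starRingEnd ℂ) _ _

theorem TestFn.adjoint_apply (f : TestFn d M n) (x : Fin n → M) :
    f.adjoint x = starRingEnd ℂ (f (x ∘ Fin.rev)) := rfl

theorem TestFn.adjoint_adjoint (f : TestFn d M n) : f.adjoint.adjoint = f := by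
  ext x
  simp [TestFn.adjoint_apply, Function.comp_def]

variable [T2Space M]

/-- The unit `1 ∈ C^∞_0(M^0) = ℂ`. -/
def TestFn.one : TestFn d M 0 :=
  .mk (fun _ => 1) contMDiff_const (HasCompactSupport.intro (K := univ)
    (by exact Set.finite_univ.isCompact) fun x hx => absurd (mem_univ x) hx)

instance : GradedMonoid.GMul fun n => TestFn d M n := ⟨fun f g => f.tensor g⟩

instance : GradedMonoid.GOne fun n => TestFn d M n := ⟨.one⟩

theorem TestFn.mk_mul_mk (f : TestFn d M n) (g : TestFn d M m) :
    GradedMonoid.mk (A := fun n => TestFn d M n) n f * GradedMonoid.mk m g =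
      GradedMonoid.mk (n + m) (f.tensor g) := rfl

instance : DirectSum.GRing fun n => TestFn d M n where
  mul_zero _ := TestFn.ext fun _ => mul_zero _
  zero_mul _ := TestFn.ext fun _ => zero_mul _
  mul_add _ _ _ := TestFn.ext fun _ => mul_add _ _ _
  add_mul _ _ _ := TestFn.ext fun _ => add_mul _ _ _
  one_mul := by
    rintro ⟨n, f⟩
    refine TestFn.gradedMonoid_ext (zero_add n) _ f fun x => ?_
    refine (one_mul _).trans (congrArg f (funext fun i => congrArg x (Fin.ext ?_)))
    simp
  mul_one := by
    rintro ⟨n, f⟩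
    exact TestFn.gradedMonoid_ext (add_zero n) _ f fun x => mul_one _
  mul_assoc := by
    rintro ⟨n, f⟩ ⟨m, g⟩ ⟨k, h⟩
    change GradedMonoid.mk (n + m + k) ((f.tensor g).tensor h) =
      GradedMonoid.mk (n + (m + k)) (f.tensor (g.tensor h))
    refine TestFn.gradedMonoid_ext (add_assoc n m k) _ _ fun x => ?_
    refine (mul_assoc _ _ _).trans (congrArg₂ (· * ·) ?_ (congrArg₂ (· * ·) ?_ ?_))
    · exact congrArg f (funext fun i => congrArg x (Fin.ext rfl))
    · exact congrArg g (funext fun i => congrArg x (Fin.ext rfl))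
    · exact congrArg h (funext fun i => congrArg x (Fin.ext (by simp [add_assoc])))
  natCast k := k • .one
  natCast_zero := zero_smul _ _
  natCast_succ k := succ_nsmul _ _
  intCast k := k • .one
  intCast_ofNat k := natCast_zsmul _ _
  intCast_negSucc_ofNat k := negSucc_zsmul _ _

instance : DirectSum.GAlgebra ℂ fun n => TestFn d M n where
  toFun :=
    { toFun := fun c => c • .one
      map_zero' := zero_smul _ _
      map_add' := fun _ _ => add_smul _ _ _ }
  map_one := one_smul _ _
  map_mul r s := by
    refine TestFn.gradedMonoid_ext rfl _ _ fun x => ?_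
    change r * s * 1 = (r * 1) * (s * 1)
    ring
  commutes r := by
    rintro ⟨n, f⟩
    change GradedMonoid.mk (0 + n) ((r • .one : TestFn d M 0).tensor f) =
      GradedMonoid.mk (n + 0) (f.tensor (r • .one))
    refine TestFn.gradedMonoid_ext ((zero_add n).trans (add_zero n).symm) _ _ fun x => ?_
    change r * 1 * f _ = f _ * (r * 1)
    rw [mul_comm]
    exact congrArg (· * (r * 1)) (congrArg f (funext fun i => congrArg x (Fin.ext (by simp))))
  smul_def r := by
    rintro ⟨n, f⟩
    change GradedMonoid.mk n (r • f) = GradedMonoid.mk (0 + n) ((r • .one : TestFn d M 0).tensor f)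
    refine TestFn.gradedMonoid_ext (zero_add n).symm _ _ fun x => ?_
    change r * f _ = r * 1 * f _
    rw [mul_one]
    exact congrArg (r * ·) (congrArg f (funext fun i => congrArg x (Fin.ext (by simp))))

theorem TestFn.of_adjoint_tensor (f : TestFn d M n) (g : TestFn d M m) :
    DirectSum.of (fun n => TestFn d M n) (n + m) (f.tensor g).adjoint =
      DirectSum.of (fun n => TestFn d M n) (m + n) (g.adjoint.tensor f.adjoint) := by
  refine DirectSum.of_eq_of_gradedMonoid_eq
    (TestFn.gradedMonoid_ext (add_comm n m) _ _ fun x => ?_)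
  change starRingEnd ℂ (f _ * g _) = starRingEnd ℂ (g _) * starRingEnd ℂ (f _)
  rw [map_mul, mul_comm]
  refine congrArg₂ (· * ·) (congrArg _ (congrArg g ?_)) (congrArg _ (congrArg f ?_))
  · refine funext fun i => congrArg x (Fin.ext ?_)
    simp [Fin.rev]; omega
  · refine funext fun i => congrArg x (Fin.ext ?_)
    simp [Fin.rev]; omega

instance : StarRing (BorchersUhlmann d M) where
  star := DirectSum.map fun _ => TestFn.adjoint
  star_involutive a := by
    change DirectSum.map _ (DirectSum.map _ a) = a
    ext1 n
    simp only [DirectSum.map_apply, TestFn.adjoint_adjoint]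
  star_add a b := map_add _ a b
  star_mul a b := by
    change DirectSum.map _ (a * b) = DirectSum.map _ b * DirectSum.map _ a
    induction a using DirectSum.induction_on with
    | zero => simp
    | add a a' ha ha' => simp [add_mul, mul_add, ha, ha']
    | of n f =>
      induction b using DirectSum.induction_on with
      | zero => simp
      | add b b' hb hb' => simp [add_mul, mul_add, hb, hb']
      | of m g =>
        simp only [DirectSum.of_mul_of, DirectSum.map_of]
        exact TestFn.of_adjoint_tensor f g

instance : StarModule ℂ (BorchersUhlmann d M) where
  star_smul c a := by
    change DirectSum.map _ (c • a) = starRingEnd ℂ c • DirectSum.map _ a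
    ext n x
    simp [DirectSum.map_apply, DirectSum.smul_apply, TestFn.adjoint_apply]

variable (d M) in
/-- The subspace `⨁_{n ≤ N} C^∞_0(K^n)`. -/
def BorchersUhlmann.step (N : ℕ) (K : Set M) : Set (BorchersUhlmann d M) :=
  {a | (∀ n, N < n → a n = 0) ∧ ∀ n, tsupport (a n) ⊆ Set.pi univ fun _ => K}

variable (d M) in
/-- The product topology of `⨁_{n ≤ N} C^∞_0(K^n)`. -/
@[reducible] def BorchersUhlmann.stepTopology (N : ℕ) (K : Set M) :
    TopologicalSpace (BorchersUhlmann.step d M N K) :=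
  .induced (fun a n => a.1 n) (@Pi.topologicalSpace ℕ (TestFn d M) fun n => smoothTopology d M n)

/-- The inductive limit topology of the subspaces `⨁_{n ≤ N} C^∞_0(K^n)`, `K` compact. -/
instance : TopologicalSpace (BorchersUhlmann d M) :=
  inductiveTopology (ι := ℕ × {K : Set M // IsCompact K})
    (W := fun i => BorchersUhlmann.step d M i.1 i.2.1)
    (fun i => BorchersUhlmann.stepTopology d M i.1 i.2.1) (fun _ a => a.1)

instance : IsTopologicalAddGroup (BorchersUhlmann d M) :=
  topologicalAddGroup_sInf fun _ h => h.2.1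
instance : ContinuousSMul ℂ (BorchersUhlmann d M) :=
  continuousSMul_sInf fun _ h => h.2.2.1
instance : LocallyConvexSpace ℝ (BorchersUhlmann d M) :=
  .sInf fun _ h => h.2.2.2

/-- The continuous inclusion of `C^∞_0(M^n)` into the Borchers-Uhlmann algebra. -/
def BorchersUhlmann.incl (n : ℕ) : TestFn d M n →L[ℂ] BorchersUhlmann d M where
  toLinearMap := DirectSum.lof ℂ ℕ (TestFn d M) n
  cont := by
    refine TestFn.continuous_of_supportedIn (DirectSum.lof ℂ ℕ (TestFn d M) n) fun K hK => ?_
    let K' : Set M := ⋃ i : Fin n, (fun x => x i) '' K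
    have hK' : IsCompact K' := isCompact_iUnion fun i => hK.image (continuous_apply i)
    let r : TestFn.supportedIn d K → BorchersUhlmann.step d M n K' := fun f =>
      ⟨DirectSum.of (TestFn d M) n f.1, fun m hm => DirectSum.of_eq_of_ne _ _ _ hm.ne', by
        intro m
        rcases eq_or_ne m n with rfl | hm
        · rw [DirectSum.of_eq_same]
          exact f.2.trans fun x hx i _ => mem_iUnion.2 ⟨i, x, hx, rfl⟩
        · rw [DirectSum.of_eq_of_ne _ _ _ hm]
          have : ((0 : TestFn d M m) : (Fin m → M) → ℂ) = 0 := rfl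
          rw [this, tsupport_zero]
          exact empty_subset _⟩
    have hr : @Continuous _ _ (.induced Subtype.val (smoothTopology d M n))
        (BorchersUhlmann.stepTopology d M n K') r := by
      refine continuous_induced_rng.2 ?_
      refine @continuous_pi _ _ _ (_) (fun n => smoothTopology d M n) _ fun m => ?_
      rcases eq_or_ne m n with rfl | hm
      · refine @Continuous.congr _ _ (_) (smoothTopology d M m) _ _ continuous_induced_dom
          fun f => ?_
        exact (DirectSum.of_eq_same m f.1).symm
      · refine @Continuous.congr _ _ (_) (smoothTopology d M m) (fun _ => 0) _
          (@continuous_const _ _ (_) (_) _) fun f => ?_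
        exact (DirectSum.of_eq_of_ne _ _ f.1 hm).symm
    have hv : @Continuous (BorchersUhlmann.step d M n K') (BorchersUhlmann d M)
        (BorchersUhlmann.stepTopology d M n K') _ Subtype.val :=
      continuous_to_inductiveTopology
        (ι := ℕ × {K : Set M // IsCompact K})
        (W := fun i => BorchersUhlmann.step d M i.1 i.2.1)
        (fun i => BorchersUhlmann.stepTopology d M i.1 i.2.1) (fun _ a => a.1) (n, ⟨K', hK'⟩)
    exact @Continuous.comp _ _ _ (_) (BorchersUhlmann.stepTopology d M n K') _ r
      Subtype.val hv hr

end Algebra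

section States

variable (d : ℕ) (M : Type u) [TopologicalSpace M] [ChartedSpace (Coord d) M]

/-- Distributions on `M^n`. -/
abbrev DistributionOn (n : ℕ) : Type u := TestFn d M n →L[ℂ] ℂ

variable {d M} in
/-- The distribution `u` with permuted arguments. -/
def DistributionOn.permute {n : ℕ} (σ : Equiv.Perm (Fin n)) (u : DistributionOn d M n) :
    DistributionOn d M n := u.comp (TestFn.permuteL σ)

variable [T2Space M]

/-- A state: a normalised continuous positive linear functional on the Borchers-Uhlmann algebra. -/
structure QuantumState where
  toCLM : BorchersUhlmann d M →L[ℂ] ℂ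
  normalised : toCLM 1 = 1
  positive : ∀ a, 0 ≤ (toCLM (star a * a)).re ∧ (toCLM (star a * a)).im = 0

variable {d M}

/-- The `n`-point distribution `ω_n`. -/
def QuantumState.nPoint (w : QuantumState d M) (n : ℕ) : DistributionOn d M n :=
  w.toCLM.comp (BorchersUhlmann.incl n)

/-- `ω_{2+}(x_2, x_1) = (ω_2(x_2, x_1) + ω_2(x_1, x_2)) / 2`. -/
def QuantumState.twoPointSym (w : QuantumState d M) : DistributionOn d M 2 :=
  (1 / 2 : ℂ) • (w.nPoint 2 + (w.nPoint 2).permute Fin.revPerm)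

/-- `ω_{2-}(x_2, x_1) = (ω_2(x_2, x_1) - ω_2(x_1, x_2)) / 2`. -/
def QuantumState.twoPointAntisym (w : QuantumState d M) : DistributionOn d M 2 :=
  (1 / 2 : ℂ) • (w.nPoint 2 - (w.nPoint 2).permute Fin.revPerm)

/-- The smeared quantum field `Φ(f)`. -/
def smearedField (f : TestFn d M 1) : BorchersUhlmann d M := BorchersUhlmann.incl 1 f

/-- Two-sided ideals that are closed under the `*`-operation. -/
def IsStarIdeal (J : Submodule ℂ (BorchersUhlmann d M)) : Prop :=
  ∀ a ∈ J, star a ∈ J ∧ ∀ b, a * b ∈ J ∧ b * a ∈ J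

/-- The `*`-ideal generated by the elements `f ⊗ h - h ⊗ f - i E(f, h) I`. -/
def commutatorIdeal (E : DistributionOn d M 2) : Submodule ℂ (BorchersUhlmann d M) :=
  sInf {J | IsStarIdeal J ∧ ∀ f h : TestFn d M 1,
    smearedField f * smearedField h - smearedField h * smearedField f -
      (Complex.I * E (f.tensor h)) • (1 : BorchersUhlmann d M) ∈ J}

/-- The state satisfies the commutation relations with commutator `E`: it descends to the quotient by
the `*`-ideal of the commutation relations (the induced functional on the quotient is then again
normalised, positive and continuous). -/
def QuantumState.IsGeneralisedFreeField (w : QuantumState d M) (E : DistributionOn d M 2) : Prop :=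
  ∀ a ∈ commutatorIdeal E, w.toCLM a = 0

end States

section WaveFront

variable {d : ℕ} {M : Type u} [TopologicalSpace M] [ChartedSpace (Coord d) M]
  [IsManifold (𝓡 d) ∞ M] {n : ℕ}

/-- `η · φ(y)` in the product chart `φ = φ_1 × ⋯ × φ_n`. -/
def phase (φ : Fin n → OpenPartialHomeomorph M (Coord d)) (η : Fin n → Coord d →L[ℝ] ℝ)
    (y : Fin n → M) : ℝ := ∑ i, η i (φ i (y i))

/-- The domain of the product chart. -/
def productSource (φ : Fin n → OpenPartialHomeomorph M (Coord d)) : Set (Fin n → M) :=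
  {y | ∀ i, y i ∈ (φ i).source}

/-- The test function `χ(y) e^{-i η · φ(y)}` for `χ` supported in the domain of the product chart `φ`.
Thus `u (χ.modulate φ _ _ η)` is the Fourier transform at `η` of the distribution `χ u` in the chart. -/
def TestFn.modulate (χ : TestFn d M n) (φ : Fin n → OpenPartialHomeomorph M (Coord d))
    (hφ : ∀ i, φ i ∈ IsManifold.maximalAtlas (𝓡 d) ∞ M)
    (hχ : tsupport χ ⊆ productSource φ) (η : Fin n → Coord d →L[ℝ] ℝ) : TestFn d M n :=
  .mk (fun y => χ y * Complex.exp (-(Complex.I * phase φ η y)))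
    (by
      refine contMDiff_of_tsupport fun y hy => ?_
      have hy' : y ∈ productSource φ := hχ (tsupport_mul_subset_left hy)
      have hph : ContMDiffAt (powModel d n) 𝓘(ℝ, ℝ) ∞ (phase φ η) y := by
        refine contMDiffAt_finsetSum fun i _ => ?_
        have h1 : ContMDiffAt (powModel d n) (𝓡 d) ∞ (fun y : Fin n → M => φ i (y i)) y :=
          (contMDiffAt_of_mem_maximalAtlas (hφ i) (hy' i)).comp y (contMDiff_eval i y)
        exact (η i).contDiff.contDiffAt.comp_contMDiffAt h1
      have hexp : ContDiff ℝ ∞ fun r : ℝ => Complex.exp (-(Complex.I * (r : ℂ))) :=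
        (contDiff_const.mul Complex.ofRealCLM.contDiff).neg.cexp
      exact contMDiffAt_mul_complex (χ.contMDiff y) (hexp.contDiffAt.comp_contMDiffAt hph))
    χ.hasCompactSupport.mul_right

variable (d M) in
/-- The cotangent bundle of `M`. A point of `T^*M^n = (T^*M)^n` is a tuple `Fin n → Covector d M`. -/
abbrev Covector : Type u := Σ x : M, TangentSpace (𝓡 d) x →L[ℝ] ℝ

/-- `(φ(x), ξ)` is not in the wave front set of `u` in the product chart `φ`: for all cut-offs `χ`
supported near `x`, the Fourier transform of `χ u` is rapidly decreasing in a fixed conic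
neighbourhood of `ξ`. -/
def IsRegularDirection (u : DistributionOn d M n) (φ : Fin n → OpenPartialHomeomorph M (Coord d))
    (hφ : ∀ i, φ i ∈ IsManifold.maximalAtlas (𝓡 d) ∞ M)
    (x : Fin n → M) (ξ : Fin n → Coord d →L[ℝ] ℝ) : Prop :=
  ∃ U ∈ 𝓝 x, ∃ V ∈ 𝓝 ξ, ∀ (χ : TestFn d M n) (hχ : tsupport χ ⊆ productSource φ),
    tsupport χ ⊆ U → ∀ N : ℕ, ∃ C : ℝ, ∀ η ∈ V, ∀ τ : ℝ, 1 ≤ τ →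
      τ ^ N * ‖u (χ.modulate φ hφ hχ (τ • η))‖ ≤ C

/-- The wave front set of `u`, as a subset of `T^*M^n` without the zero section: the union over all
product charts `φ` of the pull-backs along `φ` of the wave front sets in the charts. -/
def wavefrontSet (u : DistributionOn d M n) : Set (Fin n → Covector d M) :=
  {p | (∃ i, (p i).2 ≠ 0) ∧
    ∃ (φ : Fin n → OpenPartialHomeomorph M (Coord d))
      (hφ : ∀ i, φ i ∈ IsManifold.maximalAtlas (𝓡 d) ∞ M) (ξ : Fin n → Coord d →L[ℝ] ℝ),
      (∀ i, (p i).1 ∈ (φ i).source) ∧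
      (∀ i, (p i).2 = (ξ i).comp (mfderiv (𝓡 d) (𝓡 d) (φ i) (p i).1)) ∧
      ¬ IsRegularDirection u φ hφ (fun i => (p i).1) ξ}

/-- The point `(x, -k)` for `p = (x, k)`. -/
def negCovectors (p : Fin n → Covector d M) : Fin n → Covector d M :=
  fun i => ⟨(p i).1, -(p i).2⟩

end WaveFront

section Geometry

variable (d : ℕ) (M : Type u) [TopologicalSpace M] [ChartedSpace (Coord d) M]
  [IsManifold (𝓡 d) ∞ M]

/-- A smooth Lorentzian metric of signature `+ - ⋯ -` with a time orientation, given by a smooth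
timelike vector field that points to the future. -/
structure Spacetime where
  metric : ∀ x : M, TangentSpace (𝓡 d) x →L[ℝ] TangentSpace (𝓡 d) x →L[ℝ] ℝ
  symm : ∀ x v w, metric x v w = metric x w v
  smooth : ContMDiff (𝓡 d) ((𝓡 d).prod 𝓘(ℝ, Coord d →L[ℝ] Coord d →L[ℝ] ℝ)) ∞
    fun x => Bundle.TotalSpace.mk' (Coord d →L[ℝ] Coord d →L[ℝ] ℝ)
      (E := fun x : M => TangentSpace (𝓡 d) x →L[ℝ] TangentSpace (𝓡 d) x →L[ℝ] ℝ) x (metric x)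
  lorentzian : ∀ x, ∃ t, 0 < metric x t t ∧ ∀ v, v ≠ 0 → metric x t v = 0 → metric x v v < 0
  time : ∀ x : M, TangentSpace (𝓡 d) x
  time_smooth : ContMDiff (𝓡 d) (𝓡 d).tangent ∞ fun x => (⟨x, time x⟩ : TangentBundle (𝓡 d) M)
  time_timelike : ∀ x, 0 < metric x (time x) (time x)

variable {d M} (S : Spacetime d M)

namespace Spacetime

def flat (x : M) : TangentSpace (𝓡 d) x →ₗ[ℝ] (TangentSpace (𝓡 d) x →L[ℝ] ℝ) :=
  (S.metric x).toLinearMap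

theorem flat_injective (x : M) : Function.Injective (S.flat x) := by
  rw [← LinearMap.ker_eq_bot, LinearMap.ker_eq_bot']
  intro v hv
  have hv' : ∀ w, S.metric x v w = 0 := fun w => DFunLike.congr_fun hv w
  obtain ⟨t, _, ht⟩ := S.lorentzian x
  by_contra h
  have h1 := ht v h (by rw [S.symm]; exact hv' t)
  rw [hv' v] at h1
  exact lt_irrefl _ h1

/-- The musical isomorphism `v ↦ g(v, ·)` from tangent to cotangent vectors. -/
def flatEquiv (x : M) : TangentSpace (𝓡 d) x ≃ₗ[ℝ] (TangentSpace (𝓡 d) x →L[ℝ] ℝ) :=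
  haveI : FiniteDimensional ℝ (TangentSpace (𝓡 d) x) :=
    inferInstanceAs (FiniteDimensional ℝ (Coord d))
  LinearEquiv.ofInjectiveOfFinrankEq (S.flat x) (S.flat_injective x) (by
    have h1 : Module.finrank ℝ (TangentSpace (𝓡 d) x →L[ℝ] ℝ) =
        Module.finrank ℝ (Module.Dual ℝ (Coord d)) :=
      (LinearMap.toContinuousLinearMap (𝕜 := ℝ) (E := Coord d) (F' := ℝ)).finrank_eq.symm
    exact (h1.trans Subspace.dual_finrank_eq).symm)

/-- `ξ ↦ ξ^♯`, the inverse of `v ↦ g(v, ·)`. -/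
def sharp (x : M) : (TangentSpace (𝓡 d) x →L[ℝ] ℝ) ≃ₗ[ℝ] TangentSpace (𝓡 d) x :=
  (S.flatEquiv x).symm

/-- Nonzero causal vectors in the future cone, for the signature `+ - ⋯ -`. -/
def IsFutureCausal (x : M) (v : TangentSpace (𝓡 d) x) : Prop :=
  v ≠ 0 ∧ 0 ≤ S.metric x v v ∧ 0 < S.metric x (S.time x) v

/-- Future pointing causal covectors: the images of future pointing causal vectors under the metric. -/
def IsFutureCausalCovector (x : M) (k : TangentSpace (𝓡 d) x →L[ℝ] ℝ) : Prop :=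
  ∃ v, S.IsFutureCausal x v ∧ k = S.metric x v

/-- The components `g(∂_v, ∂_w)` of the metric in the chart `φ`, at the coordinate point `y`. -/
def chartMetric (φ : OpenPartialHomeomorph M (Coord d)) (y v w : Coord d) : ℝ :=
  S.metric (φ.symm y) (mfderiv (𝓡 d) (𝓡 d) φ.symm y v) (mfderiv (𝓡 d) (𝓡 d) φ.symm y w)

/-- The Christoffel symbols of the first kind `g(∇_u v, w)` of the Levi-Civita connection in the
chart `φ`, for constant coordinate vector fields `u, v, w`. -/
def christoffel (φ : OpenPartialHomeomorph M (Coord d)) (y u v w : Coord d) : ℝ :=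
  (fderiv ℝ (fun z => S.chartMetric φ z v w) y u + fderiv ℝ (fun z => S.chartMetric φ z u w) y v -
    fderiv ℝ (fun z => S.chartMetric φ z u v) y w) / 2

/-- `∇_{γ'} ξ = 0` along the smooth piece `γ|_s`. In a chart, `∇_{γ'} ξ = 0` reads
`d/dt (ξ v) = ξ (Γ(γ', v)) = g(Γ(γ', v), ξ^♯)` for each constant coordinate vector `v`, where
`Γ(u, v) = ∇_u v`. -/
def IsParallelOn (γ : ℝ → M) (ξ : ∀ t, TangentSpace (𝓡 d) (γ t) →L[ℝ] ℝ) (s : Set ℝ) : Prop :=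
  ∀ φ ∈ IsManifold.maximalAtlas (𝓡 d) ∞ M, ∀ t ∈ s, γ t ∈ φ.source → ∀ v : Coord d,
    HasDerivWithinAt (fun r => ξ r (mfderiv (𝓡 d) (𝓡 d) φ.symm (φ (γ r)) v))
      (S.christoffel φ (φ (γ t)) (derivWithin (φ ∘ γ) s t) v
        (mfderiv (𝓡 d) (𝓡 d) φ (γ t) (S.sharp (γ t) (ξ t)))) s t

end Spacetime

variable (d M) in
/-- A piecewise smooth curve, parametrised by `[0, 1]`: it is smooth on each of the finitely many
closed intervals between consecutive knots (hence continuous on `[0, 1]`). -/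
structure PiecewiseSmoothCurve where
  toFun : ℝ → M
  pieces : ℕ
  knot : Fin (pieces + 1) → ℝ
  knot_strictMono : StrictMono knot
  knot_zero : knot 0 = 0
  knot_last : knot (Fin.last pieces) = 1
  smooth : ∀ j : Fin pieces,
    ContMDiffOn 𝓘(ℝ, ℝ) (𝓡 d) ∞ toFun (Icc (knot j.castSucc) (knot j.succ))

/-- A graph with `n` vertices and finitely many edges (multiple edges and loops are allowed).
The two end points of an edge are listed in an arbitrary order, which carries no meaning. -/
structure FiniteGraph (n : ℕ) where
  edges : ℕ
  ends : Fin edges → Fin n × Fin n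

/-- An immersion of a graph into the spacetime: points for the vertices, piecewise smooth curves
for the edges, and along each curve a covariantly constant field of future pointing causal
covectors. -/
structure GraphImmersion {n : ℕ} (G : FiniteGraph n) where
  vertex : Fin n → M
  curve : Fin G.edges → PiecewiseSmoothCurve d M
  curve_zero : ∀ e, (curve e).toFun 0 = vertex (G.ends e).1
  curve_one : ∀ e, (curve e).toFun 1 = vertex (G.ends e).2
  covector : ∀ e t, TangentSpace (𝓡 d) ((curve e).toFun t) →L[ℝ] ℝ
  future : ∀ e, ∀ t ∈ Icc (0 : ℝ) 1, S.IsFutureCausalCovector ((curve e).toFun t) (covector e t)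
  parallel : ∀ e (j : Fin (curve e).pieces), S.IsParallelOn (curve e).toFun (covector e)
    (Icc ((curve e).knot j.castSucc) ((curve e).knot j.succ))

/-- The sign with which an edge between the vertices in positions `i` and `j` contributes to the
covector at the vertex in position `i`. Tuples are listed as `(x_n, …, x_1)`, so position `p`
carries the label `n - p`: the sign is `+1` if the label of `j` is larger than that of `i`, `-1` if
it is smaller, and `0` for a loop. -/
def edgeSign {n : ℕ} (i j : Fin n) : ℝ := if j < i then 1 else if i < j then -1 else 0

/-- The covector on an edge, read in the model space: tangent spaces of `M` at equal base points
are the same copy of the model space, so at the end points `t = 0, 1` this is a covector at the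
vertex. -/
def GraphImmersion.modelCovector {S : Spacetime d M} {n : ℕ} {G : FiniteGraph n}
    (I : GraphImmersion S G) (e : Fin G.edges) (t : ℝ) : Coord d →L[ℝ] ℝ := I.covector e t

/-- The covector `k_i` that a graph immersion induces at the vertex in position `i`: the signed sum
over the edges of the covectors at those end points that are attached to `i`. -/
def GraphImmersion.momentum {S : Spacetime d M} {n : ℕ} {G : FiniteGraph n}
    (I : GraphImmersion S G) (i : Fin n) : TangentSpace (𝓡 d) (I.vertex i) →L[ℝ] ℝ :=
  ∑ e, ((if (G.ends e).1 = i then edgeSign i (G.ends e).2 • I.modelCovector e 0 else 0) +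
    (if (G.ends e).2 = i then edgeSign i (G.ends e).1 • I.modelCovector e 1 else 0))

/-- The set `Γ_n ⊆ T^*M^n ∖ 𝒵` of points instantiated by some immersion of some graph. -/
def GammaSet (n : ℕ) : Set (Fin n → Covector d M) :=
  {p | (∃ i, (p i).2 ≠ 0) ∧ ∃ (G : FiniteGraph n) (I : GraphImmersion S G),
    ∀ i, p i = ⟨I.vertex i, I.momentum i⟩}

/-- The set `-Γ_n`. -/
def negGammaSet (n : ℕ) : Set (Fin n → Covector d M) := {p | negCovectors p ∈ GammaSet S n}

/-- The generalised Hadamard condition `WF(ω_2) ⊆ Γ_2`. -/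
def QuantumState.IsGeneralisedHadamard [T2Space M] (w : QuantumState d M) (S : Spacetime d M) :
    Prop :=
  wavefrontSet (w.nPoint 2) ⊆ GammaSet S 2

end Geometry

end QFT

end

open QFT

/-!
The wave front set relations are formal consequences of three facts.

* `ω₂` is Hermitian (`QuantumState.map_star`, by polarisation of positivity), so conjugating the test
  function changes `ω₂₊` and `ω₂₋` only by complex conjugation and a sign. Their wave front sets are
  therefore symmetric under `k ↦ -k`, and they are symmetric under exchange of the arguments because
  `ω₂±` is symmetric or antisymmetric. Wave front sets are compared in one and the
  same product chart, up to the order of its factors, so independence of the chart is never needed.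
* `Γ₂` and `-Γ₂` are disjoint (`disjoint_gammaSet_negGammaSet`): the covector at `x₁` of a point of `Γ₂`
  is a nonempty sum of future pointing covectors and is positive on the time orientation.
  Exchanging the two points maps `Γ₂` to `-Γ₂` (`negCovectors_rev_mem_gammaSet`).
* Hence `ω₂` has wave front set in `Γ₂` and the exchanged distribution has wave front set in `-Γ₂`.
  Since `ω₂₊ ± ω₂₋` are these two distributions, subadditivity of the wave front set determines
  everything separately over `Γ₂` and over `-Γ₂`.

For a generalised free field the commutation relations give `E(f ⊗ h) = -2i ω₂₋(f ⊗ h)`, and the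
equality of the two distributions needs the density of tensor products in `C^∞_0(M²)`
(`DistributionOn.eq_zero_of_tensor`). A partition of unity reduces to test functions `F` whose first
argument stays in a coordinate patch. Mollifying `F` in that argument at scale `t` produces, for `t ≠ 0`,
an integral of tensor products. Two facts on jointly smooth families of test functions with supports in
a common compact set suffice: such a family is continuous for the topology of `C^∞_0`
(`SmoothFamily.continuous_testFn`), which gives the limit `t → 0`, and a distribution that kills every
member of a family kills its integral (`DistributionOn.apply_integral_eq_zero`). The latter is proved one
variable at a time, by differentiating the partial integrals, so no vector-valued integration in
`C^∞_0` is involved.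
-/

namespace QFT

/-! ### Operations on wave front sets -/

section WaveFront

variable {d : ℕ} {M : Type*} [TopologicalSpace M] [ChartedSpace (Coord d) M]
  {n : ℕ}

theorem IsRegularDirection.add {u v : DistributionOn d M n}
    {φ : Fin n → OpenPartialHomeomorph M (Coord d)}
    {hφ : ∀ i, φ i ∈ IsManifold.maximalAtlas (𝓡 d) ∞ M} {x : Fin n → M}
    {ξ : Fin n → Coord d →L[ℝ] ℝ} (hu : IsRegularDirection u φ hφ x ξ)
    (hv : IsRegularDirection v φ hφ x ξ) : IsRegularDirection (u + v) φ hφ x ξ := by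
  obtain ⟨U, hU, V, hV, h⟩ := hu
  obtain ⟨U', hU', V', hV', h'⟩ := hv
  refine ⟨U ∩ U', Filter.inter_mem hU hU', V ∩ V', Filter.inter_mem hV hV',
    fun χ hχ hs N => ?_⟩
  obtain ⟨C, hC⟩ := h χ hχ (hs.trans inter_subset_left) N
  obtain ⟨C', hC'⟩ := h' χ hχ (hs.trans inter_subset_right) N
  refine ⟨C + C', fun η hη τ hτ => ?_⟩
  have h1 := hC η hη.1 τ hτ
  have h2 := hC' η hη.2 τ hτ
  have h0 : (0 : ℝ) ≤ τ ^ N := by positivity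
  calc _ ≤ τ ^ N * (‖u (χ.modulate φ hφ hχ (τ • η))‖ + ‖v (χ.modulate φ hφ hχ (τ • η))‖) :=
        mul_le_mul_of_nonneg_left (norm_add_le _ _) h0
    _ ≤ _ := by rw [mul_add]; exact add_le_add h1 h2

theorem IsRegularDirection.smul {u : DistributionOn d M n}
    {φ : Fin n → OpenPartialHomeomorph M (Coord d)}
    {hφ : ∀ i, φ i ∈ IsManifold.maximalAtlas (𝓡 d) ∞ M} {x : Fin n → M}
    {ξ : Fin n → Coord d →L[ℝ] ℝ} (c : ℂ) (hu : IsRegularDirection u φ hφ x ξ) :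
    IsRegularDirection (c • u) φ hφ x ξ := by
  obtain ⟨U, hU, V, hV, h⟩ := hu
  refine ⟨U, hU, V, hV, fun χ hχ hs N => ?_⟩
  obtain ⟨C, hC⟩ := h χ hχ hs N
  refine ⟨‖c‖ * C, fun η hη τ hτ => ?_⟩
  have h1 := hC η hη τ hτ
  calc _ = ‖c‖ * (τ ^ N * ‖u (χ.modulate φ hφ hχ (τ • η))‖) := by
        rw [smul_apply, norm_smul]; ring
    _ ≤ _ := mul_le_mul_of_nonneg_left h1 (norm_nonneg c)

theorem TestFn.permute_modulate (σ : Equiv.Perm (Fin n)) (χ : TestFn d M n)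
    (φ : Fin n → OpenPartialHomeomorph M (Coord d))
    (hφ : ∀ i, φ i ∈ IsManifold.maximalAtlas (𝓡 d) ∞ M)
    (hχ : tsupport χ ⊆ productSource φ)
    (hχ' : tsupport (TestFn.permute σ χ) ⊆ productSource (φ ∘ σ.symm))
    (η : Fin n → Coord d →L[ℝ] ℝ) :
    TestFn.permute σ (χ.modulate φ hφ hχ η) =
      (TestFn.permute σ χ).modulate (φ ∘ σ.symm) (fun i => hφ (σ.symm i)) hχ' (η ∘ σ.symm) := by
  ext y
  change χ (y ∘ σ) * Complex.exp (-(Complex.I * phase φ η (y ∘ σ))) =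
    χ (y ∘ σ) * Complex.exp (-(Complex.I * phase (φ ∘ σ.symm) (η ∘ σ.symm) y))
  have : phase φ η (y ∘ σ) = phase (φ ∘ σ.symm) (η ∘ σ.symm) y := by
    unfold phase
    refine Fintype.sum_equiv σ _ _ fun i => ?_
    simp
  rw [this]

theorem IsRegularDirection.permute {u : DistributionOn d M n} (σ : Equiv.Perm (Fin n))
    {φ : Fin n → OpenPartialHomeomorph M (Coord d)}
    {hφ : ∀ i, φ i ∈ IsManifold.maximalAtlas (𝓡 d) ∞ M} {x : Fin n → M}
    {ξ : Fin n → Coord d →L[ℝ] ℝ}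
    (hu : IsRegularDirection u (φ ∘ σ.symm) (fun i => hφ (σ.symm i)) (x ∘ σ.symm) (ξ ∘ σ.symm)) :
    IsRegularDirection (u.permute σ) φ hφ x ξ := by
  obtain ⟨U, hU, V, hV, h⟩ := hu
  have hc : Continuous fun y : Fin n → M => y ∘ σ.symm :=
    continuous_pi fun i => continuous_apply _
  have hc' : Continuous fun η : Fin n → Coord d →L[ℝ] ℝ => η ∘ σ.symm :=
    continuous_pi fun i => continuous_apply _
  refine ⟨_, hc.continuousAt.preimage_mem_nhds hU, _, hc'.continuousAt.preimage_mem_nhds hV,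
    fun χ hχ hs N => ?_⟩
  have key : ∀ y, y ∈ tsupport (TestFn.permute σ χ) → y ∘ σ ∈ tsupport χ := by
    intro y hy
    rw [tsupport_permute] at hy
    exact hy
  have hχ' : tsupport (TestFn.permute σ χ) ⊆ productSource (φ ∘ σ.symm) := by
    intro y hy i
    simpa using hχ (key y hy) (σ.symm i)
  have hU' : tsupport (TestFn.permute σ χ) ⊆ U := by
    intro y hy
    simpa [Function.comp_assoc] using hs (key y hy)
  obtain ⟨C, hC⟩ := h (TestFn.permute σ χ) hχ' hU' N
  refine ⟨C, fun η hη τ hτ => ?_⟩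
  have := hC _ hη τ hτ
  change τ ^ N * ‖u (TestFn.permute σ (χ.modulate φ hφ hχ (τ • η)))‖ ≤ C
  rw [TestFn.permute_modulate σ χ φ hφ hχ hχ']
  exact this

theorem TestFn.conj_modulate (χ : TestFn d M n)
    (φ : Fin n → OpenPartialHomeomorph M (Coord d))
    (hφ : ∀ i, φ i ∈ IsManifold.maximalAtlas (𝓡 d) ∞ M)
    (hχ : tsupport χ ⊆ productSource φ) (hχ' : tsupport χ.conj ⊆ productSource φ)
    (η : Fin n → Coord d →L[ℝ] ℝ) :
    (χ.modulate φ hφ hχ η).conj = χ.conj.modulate φ hφ hχ' (-η) := by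
  ext y
  change starRingEnd ℂ (χ y * Complex.exp (-(Complex.I * phase φ η y))) =
    starRingEnd ℂ (χ y) * Complex.exp (-(Complex.I * phase φ (-η) y))
  have : phase φ (-η) y = - phase φ η y := by simp [phase]
  rw [this, map_mul, ← Complex.exp_conj]
  simp

theorem TestFn.tsupport_conj (χ : TestFn d M n) : tsupport χ.conj = tsupport χ := by
  have : Function.support χ.conj = Function.support χ := by
    ext y
    change starRingEnd ℂ (χ y) ≠ 0 ↔ χ y ≠ 0
    simp
  rw [tsupport, this, tsupport]

theorem TestFn.conj_conj (χ : TestFn d M n) : χ.conj.conj = χ :=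
  TestFn.ext fun y => Complex.conj_conj (χ y)

theorem negCovectors_negCovectors (p : Fin n → Covector d M) :
    negCovectors (negCovectors p) = p :=
  funext fun i => Sigma.ext rfl (heq_of_eq (neg_neg (p i).2))

theorem wavefrontSet_add_subset (u v : DistributionOn d M n) :
    wavefrontSet (u + v) ⊆ wavefrontSet u ∪ wavefrontSet v := by
  rintro p ⟨h0, φ, hφ, ξ, h1, h2, h3⟩
  by_cases hu : IsRegularDirection u φ hφ (fun i => (p i).1) ξ
  · exact .inr ⟨h0, φ, hφ, ξ, h1, h2, fun hv => h3 (hu.add hv)⟩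
  · exact .inl ⟨h0, φ, hφ, ξ, h1, h2, hu⟩

theorem wavefrontSet_smul_subset (c : ℂ) (u : DistributionOn d M n) :
    wavefrontSet (c • u) ⊆ wavefrontSet u := by
  rintro p ⟨h0, φ, hφ, ξ, h1, h2, h3⟩
  exact ⟨h0, φ, hφ, ξ, h1, h2, fun hu => h3 (hu.smul c)⟩

theorem wavefrontSet_smul {c : ℂ} (hc : c ≠ 0) (u : DistributionOn d M n) :
    wavefrontSet (c • u) = wavefrontSet u := by
  refine (wavefrontSet_smul_subset c u).antisymm ?_
  have := wavefrontSet_smul_subset c⁻¹ (c • u)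
  rwa [smul_smul, inv_mul_cancel₀ hc, one_smul] at this

theorem wavefrontSet_permute_subset (σ : Equiv.Perm (Fin n)) (u : DistributionOn d M n)
    {p : Fin n → Covector d M} (hp : p ∈ wavefrontSet (u.permute σ)) :
    p ∘ σ.symm ∈ wavefrontSet u := by
  obtain ⟨⟨i, hi⟩, φ, hφ, ξ, h1, h2, h3⟩ := hp
  exact ⟨⟨σ i, by rwa [Function.comp_apply, σ.symm_apply_apply]⟩, φ ∘ σ.symm, fun i => hφ _, ξ ∘ σ.symm, fun i => h1 _,
    fun i => h2 _, fun hu => h3 (IsRegularDirection.permute σ hu)⟩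

/-- If `|u(f)|` does not change under complex conjugation of `f`, then the wave front set of `u` is
symmetric under `k ↦ -k`, since `χ e^{-iη·φ}` has the conjugate `χ̄ e^{iη·φ}`. -/
theorem negCovectors_mem_wavefrontSet {u : DistributionOn d M n}
    (hu : ∀ f : TestFn d M n, ‖u f.conj‖ = ‖u f‖)
    {p : Fin n → Covector d M} (hp : p ∈ wavefrontSet u) : negCovectors p ∈ wavefrontSet u := by
  obtain ⟨⟨i, hi⟩, φ, hφ, ξ, h1, h2, h3⟩ := hp
  refine ⟨⟨i, neg_ne_zero.2 hi⟩, φ, hφ, -ξ, h1, fun i => ?_, fun h => h3 ?_⟩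
  · exact congrArg Neg.neg (h2 i)
  · obtain ⟨U, hU, V, hV, h⟩ := h
    refine ⟨U, hU, -V, ?_, fun χ hχ hs N => ?_⟩
    · have := continuous_neg.continuousAt.preimage_mem_nhds (x := ξ) hV
      exact this
    · have hχ' : tsupport χ.conj ⊆ productSource φ := by rwa [TestFn.tsupport_conj]
      obtain ⟨C, hC⟩ := h χ.conj hχ' (by rwa [TestFn.tsupport_conj]) N
      refine ⟨C, fun η hη τ hτ => ?_⟩
      have h4 := hC _ hη τ hτ
      rwa [smul_neg, ← TestFn.conj_modulate χ φ hφ hχ, hu] at h4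

end WaveFront

/-! ### Hermiticity of states -/

section States

variable {d : ℕ} {M : Type*} [TopologicalSpace M] [ChartedSpace (Coord d) M]

theorem DistributionOn.permute_rev_permute_rev {n : ℕ} (u : DistributionOn d M n) :
    (u.permute Fin.revPerm).permute Fin.revPerm = u := by
  ext f
  change u _ = u f
  congr 1
  ext x
  change f ((x ∘ Fin.rev) ∘ Fin.rev) = f x
  simp [Function.comp_def]

variable [T2Space M]

/-- States are Hermitian: the values at `(1 + a)^* (1 + a)` and `(1 + i a)^* (1 + i a)` are real. -/
theorem QuantumState.map_star (w : QuantumState d M) (a : BorchersUhlmann d M) :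
    w.toCLM (star a) = starRingEnd ℂ (w.toCLM a) := by
  have h1 := (w.positive (1 + a)).2
  have h2 := (w.positive (1 + Complex.I • a)).2
  have h3 := (w.positive a).2
  have e1 : star (1 + a) * (1 + a) = 1 + a + star a + star a * a := by
    rw [star_add, star_one]; noncomm_ring
  have e2 : star (1 + Complex.I • a) * (1 + Complex.I • a) =
      1 + Complex.I • a - Complex.I • star a + star a * a := by
    rw [star_add, star_one, star_smul, Complex.star_def, Complex.conj_I]
    simp only [add_mul, mul_add, one_mul, mul_one, smul_mul_smul_comm, neg_mul,
      Complex.I_mul_I, neg_neg, one_smul, neg_smul]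
    abel
  rw [e1] at h1
  rw [e2] at h2
  simp only [map_add, map_sub, map_smul, w.normalised, Complex.add_im, Complex.sub_im,
    smul_eq_mul, Complex.I_mul_im, Complex.one_im, h3] at h1 h2
  apply Complex.ext
  · rw [Complex.conj_re]; linarith
  · rw [Complex.conj_im]; linarith

theorem QuantumState.nPoint_conj (w : QuantumState d M) (n : ℕ) (f : TestFn d M n) :
    w.nPoint n f.conj = starRingEnd ℂ ((w.nPoint n).permute Fin.revPerm f) := by
  have h : (BorchersUhlmann.incl n f.conj : BorchersUhlmann d M) =
      star (BorchersUhlmann.incl n (TestFn.permute Fin.revPerm f)) := by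
    change DirectSum.of (TestFn d M) n f.conj =
      DirectSum.map (fun _ => TestFn.adjoint) (DirectSum.of (TestFn d M) n _)
    rw [DirectSum.map_of]
    congr 1
    ext x
    change starRingEnd ℂ (f x) = starRingEnd ℂ (f ((x ∘ Fin.rev) ∘ Fin.rev))
    simp [Function.comp_def]
  exact (congrArg w.toCLM h).trans (w.map_star _)

theorem QuantumState.twoPointSym_permute (w : QuantumState d M) :
    w.twoPointSym.permute Fin.revPerm = w.twoPointSym := by
  ext f
  have := DFunLike.congr_fun (DistributionOn.permute_rev_permute_rev (w.nPoint 2)) f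
  change (1 / 2 : ℂ) * ((w.nPoint 2).permute Fin.revPerm f +
    ((w.nPoint 2).permute Fin.revPerm).permute Fin.revPerm f) =
    (1 / 2 : ℂ) * (w.nPoint 2 f + (w.nPoint 2).permute Fin.revPerm f)
  rw [this, add_comm]

theorem QuantumState.twoPointAntisym_permute (w : QuantumState d M) :
    w.twoPointAntisym.permute Fin.revPerm = (-1 : ℂ) • w.twoPointAntisym := by
  ext f
  have := DFunLike.congr_fun (DistributionOn.permute_rev_permute_rev (w.nPoint 2)) f
  change (1 / 2 : ℂ) * ((w.nPoint 2).permute Fin.revPerm f -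
    ((w.nPoint 2).permute Fin.revPerm).permute Fin.revPerm f) =
    (-1 : ℂ) * ((1 / 2 : ℂ) * (w.nPoint 2 f - (w.nPoint 2).permute Fin.revPerm f))
  rw [this]
  ring

theorem QuantumState.permute_rev_nPoint_conj (w : QuantumState d M) (n : ℕ) (f : TestFn d M n) :
    (w.nPoint n).permute Fin.revPerm f.conj = starRingEnd ℂ (w.nPoint n f) := by
  have h := w.nPoint_conj n f.conj
  rw [TestFn.conj_conj] at h
  rw [h, Complex.conj_conj]

theorem QuantumState.norm_twoPointSym_conj (w : QuantumState d M) (f : TestFn d M 2) :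
    ‖w.twoPointSym f.conj‖ = ‖w.twoPointSym f‖ := by
  have h : w.twoPointSym f.conj = starRingEnd ℂ (w.twoPointSym f) := by
    change (1 / 2 : ℂ) * (w.nPoint 2 f.conj + (w.nPoint 2).permute Fin.revPerm f.conj) =
      starRingEnd ℂ ((1 / 2 : ℂ) * (w.nPoint 2 f + (w.nPoint 2).permute Fin.revPerm f))
    rw [w.nPoint_conj, w.permute_rev_nPoint_conj]
    rw [map_mul, map_add, map_div₀, map_one, Complex.conj_ofNat, add_comm]
  rw [h, Complex.norm_conj]

theorem QuantumState.norm_twoPointAntisym_conj (w : QuantumState d M) (f : TestFn d M 2) :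
    ‖w.twoPointAntisym f.conj‖ = ‖w.twoPointAntisym f‖ := by
  have h : w.twoPointAntisym f.conj = -starRingEnd ℂ (w.twoPointAntisym f) := by
    change (1 / 2 : ℂ) * (w.nPoint 2 f.conj - (w.nPoint 2).permute Fin.revPerm f.conj) =
      -starRingEnd ℂ ((1 / 2 : ℂ) * (w.nPoint 2 f - (w.nPoint 2).permute Fin.revPerm f))
    rw [w.nPoint_conj, w.permute_rev_nPoint_conj]
    rw [map_mul, map_sub, map_div₀, map_one, Complex.conj_ofNat]
    ring
  rw [h, norm_neg, Complex.norm_conj]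

end States

/-! ### The geometry of `Γ₂` -/

section Geometry

variable {d : ℕ} {M : Type*} [TopologicalSpace M] [ChartedSpace (Coord d) M]
  [IsManifold (𝓡 d) ∞ M] {S : Spacetime d M}

theorem Spacetime.IsFutureCausalCovector.apply_time_pos {x : M}
    {k : TangentSpace (𝓡 d) x →L[ℝ] ℝ} (hk : S.IsFutureCausalCovector x k) :
    0 < k (S.time x) := by
  obtain ⟨v, hv, rfl⟩ := hk
  rw [S.symm]
  exact hv.2.2

theorem edgeSign_rev {n : ℕ} (i j : Fin n) : edgeSign i.rev j.rev = -edgeSign i j := by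
  unfold edgeSign
  simp only [Fin.rev_lt_rev]
  rcases lt_trichotomy i j with h | h | h
  · simp [h, h.not_gt]
  · simp [h]
  · simp [h, h.not_gt]

/-- Exchanging the vertices of a graph reverses the sign of every edge: reversing the order of the points
maps `Γ_n` to `-Γ_n`. -/
theorem negCovectors_rev_mem_gammaSet {n : ℕ} {p : Fin n → Covector d M}
    (hp : p ∈ GammaSet S n) : negCovectors (p ∘ Fin.rev) ∈ GammaSet S n := by
  obtain ⟨⟨i, hi⟩, G, I, hI⟩ := hp
  let G' : FiniteGraph n := ⟨G.edges, fun e => ((G.ends e).1.rev, (G.ends e).2.rev)⟩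
  let I' : GraphImmersion S G' :=
    { vertex := I.vertex ∘ Fin.rev
      curve := I.curve
      curve_zero := fun e => by simpa [G'] using I.curve_zero e
      curve_one := fun e => by simpa [G'] using I.curve_one e
      covector := I.covector
      future := I.future
      parallel := I.parallel }
  have hm : ∀ j, (I'.momentum j : Coord d →L[ℝ] ℝ) = -(I.momentum j.rev : Coord d →L[ℝ] ℝ) := by
    intro j
    change (∑ e, ((if (G.ends e).1.rev = j then edgeSign j (G.ends e).2.rev • I.modelCovector e 0
        else 0) + (if (G.ends e).2.rev = j then edgeSign j (G.ends e).1.rev •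
          I.modelCovector e 1 else 0)) : Coord d →L[ℝ] ℝ) =
      -(∑ e, ((if (G.ends e).1 = j.rev then edgeSign j.rev (G.ends e).2 • I.modelCovector e 0
        else 0) + (if (G.ends e).2 = j.rev then edgeSign j.rev (G.ends e).1 •
          I.modelCovector e 1 else 0)) : Coord d →L[ℝ] ℝ)
    rw [← Finset.sum_neg_distrib]
    refine Finset.sum_congr rfl fun e _ => ?_
    have hs : ∀ i : Fin n, edgeSign j i.rev = -edgeSign j.rev i := fun i => by
      rw [← edgeSign_rev, Fin.rev_rev]
    simp only [Fin.rev_eq_iff, hs]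
    rw [neg_add]
    congr 1 <;> split_ifs
    · exact neg_smul (edgeSign j.rev (G.ends e).2) (I.modelCovector e 0)
    · exact (neg_zero (G := Coord d →L[ℝ] ℝ)).symm
    · exact neg_smul (edgeSign j.rev (G.ends e).1) (I.modelCovector e 1)
    · exact (neg_zero (G := Coord d →L[ℝ] ℝ)).symm
  refine ⟨⟨i.rev, ?_⟩, G', I', fun j => ?_⟩
  · change -(p i.rev.rev).2 ≠ 0
    rw [Fin.rev_rev]
    exact neg_ne_zero.2 hi
  · change (⟨(p j.rev).1, -(p j.rev).2⟩ : Covector d M) = _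
    rw [hI]
    exact Sigma.ext rfl (heq_of_eq (hm j).symm)

/-- The covector at position `1` of a point of `Γ₂` is a nonempty sum of future pointing
covectors, hence positive on the time orientation. -/
theorem apply_time_pos_of_mem_gammaSet {p : Fin 2 → Covector d M} (hp : p ∈ GammaSet S 2) :
    0 < (p 1).2 (S.time (p 1).1) := by
  obtain ⟨⟨i, hi⟩, G, I, hI⟩ := hp
  let T : M → Coord d := S.time
  have h0 : ∀ e, 0 < I.modelCovector e 0 (T (I.vertex (G.ends e).1)) := fun e => by
    rw [← I.curve_zero]
    exact (I.future e 0 (by simp)).apply_time_pos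
  have h1 : ∀ e, 0 < I.modelCovector e 1 (T (I.vertex (G.ends e).2)) := fun e => by
    rw [← I.curve_one]
    exact (I.future e 1 (by simp)).apply_time_pos
  rw [hI]
  change 0 < (∑ e, ((if (G.ends e).1 = 1 then edgeSign 1 (G.ends e).2 • I.modelCovector e 0
        else 0) + (if (G.ends e).2 = 1 then edgeSign 1 (G.ends e).1 •
          I.modelCovector e 1 else 0)) : Coord d →L[ℝ] ℝ) (T (I.vertex 1))
  rw [sum_apply]
  have hS : edgeSign (1 : Fin 2) 0 = 1 := by simp [edgeSign]
  have hS' : edgeSign (1 : Fin 2) 1 = 0 := by simp [edgeSign]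
  have hS'' : edgeSign (0 : Fin 2) 0 = 0 := by simp [edgeSign]
  have hcase : ∀ a : Fin 2, a = 0 ∨ a = 1 := by decide
  refine Finset.sum_pos' (fun e _ => ?_) ?_
  · rcases hcase (G.ends e).1 with ha | ha <;> rcases hcase (G.ends e).2 with hb | hb
    · simp [ha, hb]
    · have := h1 e
      simp only [hb] at this
      simp [ha, hb, hS, this.le]
    · have := h0 e
      simp only [ha] at this
      simp [ha, hb, hS, this.le]
    · simp [ha, hb, hS']
  · -- if all edges were loops, all momenta would vanish
    by_contra hne
    push Not at hne
    have hloop : ∀ e, (G.ends e).1 = (G.ends e).2 := by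
      intro e
      have h2 := hne e (Finset.mem_univ e)
      rcases hcase (G.ends e).1 with ha | ha <;> rcases hcase (G.ends e).2 with hb | hb
      · rw [ha, hb]
      · have := h1 e
        simp only [hb] at this
        simp [ha, hb, hS] at h2
        exact absurd this h2.not_gt
      · have := h0 e
        simp only [ha] at this
        simp [ha, hb, hS] at h2
        exact absurd this h2.not_gt
      · rw [ha, hb]
    apply hi
    rw [hI]
    change (∑ e, ((if (G.ends e).1 = i then edgeSign i (G.ends e).2 • I.modelCovector e 0
        else 0) + (if (G.ends e).2 = i then edgeSign i (G.ends e).1 •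
          I.modelCovector e 1 else 0)) : Coord d →L[ℝ] ℝ) = 0
    refine Finset.sum_eq_zero fun e _ => ?_
    rw [hloop e]
    split_ifs with h
    · rw [h]; simp [edgeSign]
    · simp

theorem disjoint_gammaSet_negGammaSet : Disjoint (GammaSet S 2) (negGammaSet S 2) := by
  refine Set.disjoint_left.2 fun p hp hn => ?_
  have h1 := apply_time_pos_of_mem_gammaSet hp
  have h2 := apply_time_pos_of_mem_gammaSet hn
  change 0 < (-(p 1).2) (S.time (p 1).1) at h2
  have h3 : (-(p 1).2) (S.time (p 1).1) = -((p 1).2 (S.time (p 1).1)) := rfl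
  linarith

end Geometry

/-! ### Smooth families of functions on `M^n` -/

section SmoothFamily

variable {d : ℕ} {M : Type*} [TopologicalSpace M] [ChartedSpace (Coord d) M] {n : ℕ}
  {P Z : Type*} [NormedAddCommGroup P] [NormedSpace ℝ P] [NormedAddCommGroup Z] [NormedSpace ℝ Z]

variable (d) in
/-- A family of functions on `M^n` that depends jointly smoothly on a parameter in a normed space and
on the point of `M^n`. -/
def SmoothFamily (G : P → (Fin n → M) → ℂ) : Prop :=
  ContMDiff (𝓘(ℝ, P).prod (powModel d n)) 𝓘(ℝ, ℂ) ∞ (Function.uncurry G)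

theorem SmoothFamily.comp {G : P → (Fin n → M) → ℂ} (hG : SmoothFamily d G) {a : Z → P}
    (ha : ContDiff ℝ ∞ a) : SmoothFamily d fun z => G (a z) :=
  ContMDiff.comp hG ((ha.contMDiff.comp contMDiff_fst).prodMk contMDiff_snd)

theorem SmoothFamily.contMDiff {G : P → (Fin n → M) → ℂ} (hG : SmoothFamily d G) (p : P) :
    ContMDiff (powModel d n) 𝓘(ℝ, ℂ) ∞ (G p) :=
  ContMDiff.comp (g := Function.uncurry G) hG (contMDiff_const.prodMk contMDiff_id)

theorem contMDiffOn_powChart_symm [IsManifold (𝓡 d) ∞ M] (x : Fin n → M) :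
    ContMDiffOn 𝓘(ℝ, Fin n → Coord d) (powModel d n) ∞ (extChartAt (powModel d n) x).symm
      (extChartAt (powModel d n) x).target := by
  intro y hy
  have hyi : ∀ i, y i ∈ (extChartAt (𝓡 d) (x i)).target := fun i => by
    simp only [extChartAt, OpenPartialHomeomorph.extend, piChartedSpace_chartAt,
      PartialEquiv.trans_target] at hy
    simpa [extChartAt] using (show y i ∈ (chartAt (Coord d) (x i)).target from hy.2 i (mem_univ i))
  refine ContMDiffAt.contMDiffWithinAt (contMDiffAt_iff_target.2 ⟨?_, ?_⟩)
  · refine continuousAt_pi.2 fun i => ?_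
    exact (continuousAt_extChartAt_symm'' (hyi i)).comp
      (f := fun y : Fin n → Coord d => y i) (continuous_apply i).continuousAt
  · refine contMDiffAt_pi_space.2 fun i => ?_
    have h := ((contMDiffOn_extChartAt_symm (I := 𝓡 d) (n := ∞) (x i)).contMDiffAt
      ((isOpen_extChartAt_target (x i)).mem_nhds (hyi i)))
    have h2 := h.comp y (f := fun y : Fin n → Coord d => y i)
      (contDiff_apply ℝ (Coord d) i).contMDiff.contMDiffAt
    exact (contMDiffAt_iff_target.1 h2).2

theorem SmoothFamily.contDiffOn [IsManifold (𝓡 d) ∞ M] {G : P → (Fin n → M) → ℂ}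
    (hG : SmoothFamily d G) (x : Fin n → M) :
    ContDiffOn ℝ ∞ (fun q : P × (Fin n → Coord d) => G q.1 ((extChartAt (powModel d n) x).symm q.2))
      (univ ×ˢ (extChartAt (powModel d n) x).target) := by
  rw [← contMDiffOn_iff_contDiffOn]
  refine ContMDiff.comp_contMDiffOn hG (f := fun q : P × (Fin n → Coord d) =>
    (q.1, (extChartAt (powModel d n) x).symm q.2)) (ContMDiffOn.prodMk ?_ ?_)
  · exact contDiff_fst.contMDiff.contMDiffOn
  · exact (contMDiffOn_powChart_symm x).comp contDiff_snd.contMDiff.contMDiffOn fun q hq => hq.2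

theorem isOpen_powChart_target (x : Fin n → M) :
    IsOpen (extChartAt (powModel d n) x).target :=
  haveI : (powModel d n).Boundaryless := ⟨by simp [powModel, ModelWithCorners.pi]⟩
  isOpen_extChartAt_target x

theorem SmoothFamily.of_contDiffOn {G : P → (Fin n → M) → ℂ}
    (h : ∀ x : Fin n → M, ContDiffOn ℝ ∞
      (fun q : P × (Fin n → Coord d) => G q.1 ((extChartAt (powModel d n) x).symm q.2))
      (univ ×ˢ (extChartAt (powModel d n) x).target)) : SmoothFamily d G := by
  rintro ⟨p, x⟩
  have hs : univ ×ˢ (extChartAt (powModel d n) x).target ∈ 𝓝 (p, extChartAt (powModel d n) x x) :=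
    (isOpen_univ.prod (isOpen_powChart_target x)).mem_nhds ⟨mem_univ _, mem_extChartAt_target x⟩
  have h1 := (h x).contDiffAt hs
  have h3 : ContMDiffAt (𝓘(ℝ, P).prod (powModel d n)) 𝓘(ℝ, Fin n → Coord d) ∞
      (fun q : P × (Fin n → M) => extChartAt (powModel d n) x q.2) (p, x) :=
    ContMDiffAt.comp (I' := powModel d n) (g := extChartAt (powModel d n) x) (f := Prod.snd) (p, x)
      contMDiffAt_extChartAt contMDiffAt_snd
  have h2 : ContMDiffAt (𝓘(ℝ, P).prod (powModel d n)) 𝓘(ℝ, P × (Fin n → Coord d)) ∞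
      (fun q : P × (Fin n → M) => (q.1, extChartAt (powModel d n) x q.2)) (p, x) :=
    contMDiffAt_fst.prodMk_space h3
  have h4 := ContDiffAt.comp_contMDiffAt (x := (p, x))
    (f := fun q : P × (Fin n → M) => (q.1, extChartAt (powModel d n) x q.2)) h1 h2
  refine ContMDiffAt.congr_of_eventuallyEq h4 ?_
  have : ∀ᶠ q : P × (Fin n → M) in 𝓝 (p, x), q.2 ∈ (extChartAt (powModel d n) x).source :=
    continuous_snd.continuousAt.eventually_mem (extChartAt_source_mem_nhds x)
  filter_upwards [this] with q hq
  exact congrArg (G q.1) ((extChartAt (powModel d n) x).left_inv hq).symm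

/-- Partial derivatives in the second variable of a jointly smooth function are jointly smooth. -/
theorem contDiffAt_iteratedFDeriv_param {V F : Type*} [NormedAddCommGroup V] [NormedSpace ℝ V]
    [NormedAddCommGroup F] [NormedSpace ℝ F] {g : P → V → F} {p : P} {y : V}
    (hg : ContDiffAt ℝ ∞ (Function.uncurry g) (p, y)) (k : ℕ) :
    ContDiffAt ℝ ∞ (fun q : P × V => iteratedFDeriv ℝ k (g q.1) q.2) (p, y) := by
  induction k with
  | zero =>
    simp only [iteratedFDeriv_zero_eq_comp, Function.comp_def]
    exact ((continuousMultilinearCurryFin0 ℝ V F).symm.contDiff.contDiffAt.comp _ hg)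
  | succ k ih =>
    simp only [iteratedFDeriv_succ_eq_comp_left, Function.comp_def]
    have hL : ContDiff ℝ ∞
        (continuousMultilinearCurryLeftEquiv ℝ (fun _ : Fin (k + 1) => V) F).symm :=
      LinearIsometryEquiv.contDiff _
    refine hL.contDiffAt.comp (p, y) ?_
    refine ContDiffAt.fderiv (n := ∞) (f := fun (q : P × V) => iteratedFDeriv ℝ k (g q.1))
      (g := Prod.snd) ?_ contDiffAt_snd le_rfl
    exact ContDiffAt.comp (g := (fun q : P × V => iteratedFDeriv ℝ k (g q.1) q.2))
      (f := fun r : (P × V) × V => (r.1.1, r.2)) ((p, y), y) ih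
      (contDiffAt_fst.fst.prodMk contDiffAt_snd)

end SmoothFamily

section Families

open MeasureTheory

variable {d : ℕ} {M : Type*} [TopologicalSpace M] [ChartedSpace (Coord d) M] {n : ℕ}
  {P Z : Type*} [NormedAddCommGroup P] [NormedSpace ℝ P] [NormedAddCommGroup Z] [NormedSpace ℝ Z]

/-- The members of a smooth family with supports in a common compact set, as test functions. -/
def SmoothFamily.testFn [T2Space M] {G : P → (Fin n → M) → ℂ} (hG : SmoothFamily d G)
    {K : Set (Fin n → M)} (hK : IsCompact K) (h0 : ∀ p, ∀ x ∉ K, G p x = 0) (p : P) :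
    TestFn d M n :=
  .mk (G p) (hG.contMDiff p) (HasCompactSupport.intro hK (h0 p))

/-- A smooth family with supports in a common compact set is a continuous curve of test functions:
in each chart, all derivatives are jointly continuous, hence continuous in the parameter uniformly on
compact sets. -/
theorem SmoothFamily.continuous_testFn [T2Space M] [IsManifold (𝓡 d) ∞ M]
    {G : P → (Fin n → M) → ℂ} (hG : SmoothFamily d G)
    {K : Set (Fin n → M)} (hK : IsCompact K) (h0 : ∀ p, ∀ x ∉ K, G p x = 0) :
    Continuous (hG.testFn hK h0) := by
  have hsupp : ∀ p, tsupport (hG.testFn hK h0 p) ⊆ K := fun p =>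
    closure_minimal (fun x hx => by_contra fun hxK => hx (h0 p x hxK)) hK.isClosed
  let r : P → TestFn.supportedIn d K := fun p => ⟨hG.testFn hK h0 p, hsupp p⟩
  have hr : @Continuous _ _ _ (.induced Subtype.val (smoothTopology d M n)) r := by
    refine continuous_induced_rng.2 (continuous_iInf_rng.2 fun x => continuous_iInf_rng.2 fun k =>
      continuous_induced_rng.2 (continuous_iff_continuousAt.2 fun p => ?_))
    refine UniformOnFun.tendsto_iff_tendstoUniformlyOn.2 ?_
    rintro L ⟨hL, hLx⟩ v hv
    have hc : ContinuousOn (Function.uncurry fun (p : P) (y : Fin n → Coord d) =>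
        iteratedFDeriv ℝ k (fun y => G p ((extChartAt (powModel d n) x).symm y)) y)
        (univ ×ˢ L) := by
      rintro ⟨p, y⟩ ⟨-, hy⟩
      refine ContinuousAt.continuousWithinAt ?_
      refine (contDiffAt_iteratedFDeriv_param
        (g := fun p y => G p ((extChartAt (powModel d n) x).symm y)) ?_ k).continuousAt
      exact (hG.contDiffOn x).contDiffAt
        ((isOpen_univ.prod (isOpen_powChart_target x)).mem_nhds ⟨mem_univ _, hLx hy⟩)
    obtain ⟨N, hN, h⟩ := hL.mem_uniformity_of_prod hc (mem_univ p) (tendsto_swap_uniformity hv)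
    rw [nhdsWithin_univ] at hN
    filter_upwards [hN] with q hq y hy
    exact h q hq y hy
  exact @Continuous.comp _ _ _ _ (.induced Subtype.val (smoothTopology d M n)) _ r
      Subtype.val (TestFn.continuous_supportedIn_val hK) hr

/-- Integrals of smooth families over compact parameter sets are smooth families. -/
theorem SmoothFamily.setIntegral [IsManifold (𝓡 d) ∞ M] [FiniteDimensional ℝ Z]
    [MeasurableSpace Z] [BorelSpace Z] {μ : Measure Z} [IsLocallyFiniteMeasure μ]
    {G : Z × P → (Fin n → M) → ℂ} (hG : SmoothFamily d G) {L : Set Z} (hL : IsCompact L) :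
    SmoothFamily d fun (p : P) x => ∫ z in L, G (z, p) x ∂μ := by
  -- in a chart the integral is the value at `0` of the convolution with `1` over `L` of `g`, where `κ`
  -- is `1` on `L` and makes `g` compactly supported
  refine SmoothFamily.of_contDiffOn fun x => ?_
  obtain ⟨R, hR0, hR⟩ := hL.isBounded.subset_closedBall_lt 0 0
  let κ : ContDiffBump (0 : Z) := ⟨R, R + 1, hR0, by linarith⟩
  let g : P × (Fin n → Coord d) → Z → ℂ := fun q z =>
    κ (-z) • G (-z, q.1) ((extChartAt (powModel d n) x).symm q.2)
  have hg : ContDiffOn ℝ ∞ (Function.uncurry g)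
      ((univ ×ˢ (extChartAt (powModel d n) x).target) ×ˢ univ) := by
    have h1 : ContDiffOn ℝ ∞ (fun r : (P × (Fin n → Coord d)) × Z => κ (-r.2))
        ((univ ×ˢ (extChartAt (powModel d n) x).target) ×ˢ univ) :=
      (κ.contDiff.comp contDiff_snd.neg).contDiffOn
    refine h1.smul ((hG.contDiffOn x).comp (f := fun r : (P × (Fin n → Coord d)) × Z =>
      ((-r.2, r.1.1), r.1.2)) ?_ fun r hr => ⟨mem_univ _, hr.1.2⟩)
    exact ((contDiff_snd.neg.prodMk contDiff_fst.fst).prodMk contDiff_fst.snd).contDiffOn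
  have := contDiffOn_convolution_right_with_param_comp (μ := μ.restrict L) (n := ⊤) (g := g)
    (s := univ ×ˢ (extChartAt (powModel d n) x).target)
    (f := fun _ : Z => (1 : ℝ)) (k := Metric.closedBall 0 (R + 1))
    (ContinuousLinearMap.lsmul ℝ ℝ) (v := fun _ => (0 : Z)) contDiffOn_const
    (isOpen_univ.prod (isOpen_powChart_target x)) (isCompact_closedBall _ _) ?_
    (locallyIntegrable_const 1) hg
  · refine this.congr fun q hq => ?_
    rw [convolution_def]
    refine setIntegral_congr_fun hL.measurableSet fun z hz => ?_
    have hκ : κ z = 1 := κ.one_of_mem_closedBall (hR hz)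
    simp [g, hκ]
  · intro q z _ hz
    have : κ (-z) = 0 := by
      apply κ.zero_of_le_dist
      simp only [Metric.mem_closedBall, dist_zero_right, not_le] at hz
      simpa [κ] using hz.le
    simp [g, this]

end Families

/-! ### Distributions applied to integrals of smooth families -/

section Averages

open MeasureTheory

variable {d : ℕ} {M : Type*} [TopologicalSpace M] [ChartedSpace (Coord d) M] {n : ℕ}
  [T2Space M] [IsManifold (𝓡 d) ∞ M]

/-- If a distribution vanishes on all members of a smooth one-parameter family, it vanishes on the
integral of the family. The partial integrals `I(r) = ∫_{-R}^r G_s ds` have difference quotients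
`∫_0^1 G_{r + h σ} dσ`, a smooth family in `h`, so that `r ↦ u(I(r))` has derivative `u(G_r) = 0`. -/
theorem DistributionOn.apply_integral_real_eq_zero (u : DistributionOn d M n)
    {G : ℝ → (Fin n → M) → ℂ} (hG : SmoothFamily d G)
    {K : Set (Fin n → M)} (hK : IsCompact K) (h0 : ∀ p, ∀ x ∉ K, G p x = 0)
    {R : ℝ} (hR : ∀ s ∉ Icc (-R) R, ∀ x, G s x = 0)
    (hu : ∀ s, u (hG.testFn hK h0 s) = 0)
    (f : TestFn d M n) (hf : ∀ x, f x = ∫ s, G s x) : u f = 0 := by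
  let D : ℝ × ℝ → (Fin n → M) → ℂ := fun a x => ∫ σ in Icc (0 : ℝ) 1, G (a.1 + a.2 * σ) x
  have hD : SmoothFamily d D :=
    (hG.comp (a := fun q : ℝ × (ℝ × ℝ) => q.2.1 + q.2.2 * q.1)
      (contDiff_snd.fst.add (contDiff_snd.snd.mul contDiff_fst))).setIntegral isCompact_Icc
  have hD0 : ∀ a, ∀ x ∉ K, D a x = 0 := fun a x hx => by simp [D, h0 _ x hx]
  have hcont : ∀ x, Continuous fun s => G s x := fun x =>
    (ContMDiff.continuous hG).comp (continuous_id.prodMk continuous_const)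
  have hDint : ∀ a x, (a.2 : ℂ) * D a x = ∫ s in a.1..(a.1 + a.2), G s x := fun a x => by
    have := intervalIntegral.smul_integral_comp_add_mul (a := 0) (b := 1)
      (fun s => G s x) a.2 a.1
    rw [mul_zero, mul_one, add_zero, intervalIntegral.integral_of_le zero_le_one,
      ← integral_Icc_eq_integral_Ioc, Complex.real_smul] at this
    exact this
  -- the partial integrals, started at a point where the family vanishes
  let I : ℝ → TestFn d M n := fun r =>
    ((r + (R + 1) : ℝ) : ℂ) • hD.testFn hK hD0 (-(R + 1), r + (R + 1))
  have hI : ∀ r x, I r x = ∫ s in -(R + 1)..r, G s x := fun r x => by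
    have := hDint (-(R + 1), r + (R + 1)) x
    rw [show -(R + 1) + (r + (R + 1)) = r by ring] at this
    exact this
  have hdiff : ∀ r h, I (r + h) - I r = (h : ℂ) • hD.testFn hK hD0 (r, h) := fun r h => by
    ext x
    change I (r + h) x + -(I r x) = (h : ℂ) * D (r, h) x
    rw [hDint (r, h) x, hI, hI, ← sub_eq_add_neg, intervalIntegral.integral_interval_sub_left]
    · exact (hcont x).intervalIntegrable _ _
    · exact (hcont x).intervalIntegrable _ _
  have hderiv : ∀ r, HasDerivAt (fun r => u (I r)) 0 r := fun r => by
    rw [hasDerivAt_iff_tendsto_slope_zero]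
    have h1 : Filter.Tendsto (fun h : ℝ => u (hD.testFn hK hD0 (r, h))) (𝓝 0)
        (𝓝 (u (hD.testFn hK hD0 (r, 0)))) :=
      ((u.continuous.comp (hD.continuous_testFn hK hD0)).comp
        (continuous_const.prodMk continuous_id)).continuousAt
    have h2 : hD.testFn hK hD0 (r, 0) = hG.testFn hK h0 r := by
      ext x
      change ∫ σ in Icc (0 : ℝ) 1, G (r + 0 * σ) x = G r x
      simp
    rw [h2, hu] at h1
    refine (h1.mono_left nhdsWithin_le_nhds).congr' ?_
    filter_upwards [self_mem_nhdsWithin] with h hh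
    rw [← map_sub, hdiff, map_smul, Complex.real_smul, smul_eq_mul, ← mul_assoc,
      ← Complex.ofReal_mul, inv_mul_cancel₀ hh, Complex.ofReal_one, one_mul]
  have hconst := is_const_of_deriv_eq_zero (f := fun r => u (I r))
    (fun r => (hderiv r).differentiableAt) (fun r => (hderiv r).deriv)
  have hfI : f = I (R + 1) := by
    ext x
    rw [hf, hI, intervalIntegral.integral_eq_integral_of_support_subset]
    intro s hs
    have : s ∈ Icc (-R) R := by_contra fun h => hs (hR s h x)
    exact ⟨by linarith [this.1], by linarith [this.2]⟩
  have hI0 : I (-(R + 1)) = 0 := by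
    ext x
    rw [hI, intervalIntegral.integral_same]
    rfl
  rw [hfI, hconst (R + 1) (-(R + 1)), hI0, map_zero]

/-- If a distribution vanishes on all members of a smooth compactly supported family, it vanishes on
the integral of the family over all parameters. -/
theorem DistributionOn.apply_integral_eq_zero (u : DistributionOn d M n) {k : ℕ}
    {G : (Fin k → ℝ) → (Fin n → M) → ℂ} (hG : SmoothFamily d G)
    {K : Set (Fin n → M)} (hK : IsCompact K) (h0 : ∀ p, ∀ x ∉ K, G p x = 0)
    {R : ℝ} (hR : ∀ z, ∀ i, z i ∉ Icc (-R) R → ∀ x, G z x = 0)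
    (hu : ∀ z, u (hG.testFn hK h0 z) = 0)
    (f : TestFn d M n) (hf : ∀ x, f x = ∫ z, G z x) : u f = 0 := by
  induction k generalizing f with
  | zero =>
    have : f = hG.testFn hK h0 default := by
      ext x
      rw [hf, Measure.volume_pi_eq_dirac default, integral_dirac]
      rfl
    rw [this, hu]
  | succ k ih =>
    have hcons : ContDiff ℝ ∞ fun q : (Fin k → ℝ) × ℝ => (Fin.cons q.2 q.1 : Fin (k + 1) → ℝ) := by
      refine contDiff_pi.2 fun i => ?_
      refine Fin.cases ?_ (fun i => ?_) i
      · simpa using contDiff_snd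
      · simpa [Function.comp_def] using (contDiff_apply ℝ ℝ i).comp contDiff_fst
    let B : Set (Fin k → ℝ) := Set.pi univ fun _ => Icc (-R) R
    have hB : IsCompact B := isCompact_univ_pi fun _ => isCompact_Icc
    have hB0 : ∀ z ∉ B, ∀ s x, G (Fin.cons s z) x = 0 := fun z hz s x => by
      simp only [B, mem_univ_pi, not_forall] at hz
      obtain ⟨i, hi⟩ := hz
      exact hR _ i.succ (by simpa using hi) x
    have hH : SmoothFamily d fun (s : ℝ) x => ∫ z in B, G (Fin.cons s z) x :=
      (hG.comp hcons).setIntegral hB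
    have hH0 : ∀ s : ℝ, ∀ x ∉ K, ∫ z in B, G (Fin.cons s z) x = 0 := fun s x hx => by
      simp [h0 _ x hx]
    refine u.apply_integral_real_eq_zero hH hK hH0 (R := R) (fun s hs x => ?_) (fun s => ?_) f
      fun x => ?_
    · have : ∀ z : Fin k → ℝ, G (Fin.cons s z) x = 0 := fun z => hR _ 0 (by simpa using hs) x
      simp [this]
    · have hGs : SmoothFamily d fun z : Fin k → ℝ => G (Fin.cons s z) :=
        hG.comp (hcons.comp (contDiff_id.prodMk contDiff_const))
      refine ih hGs (fun z => h0 _) (fun z i hi x => hR _ i.succ (by simpa using hi) x)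
        (fun z => hu _) _ fun x => ?_
      refine setIntegral_eq_integral_of_forall_compl_eq_zero fun z hz => hB0 z hz s x
    · have hcont : Continuous fun z => G z x :=
        (ContMDiff.continuous hG).comp (continuous_id.prodMk continuous_const)
      have hcpt : HasCompactSupport fun q : ℝ × (Fin k → ℝ) => G (Fin.cons q.1 q.2) x := by
        refine HasCompactSupport.intro ((isCompact_Icc (a := -R) (b := R)).prod hB) fun q hq => ?_
        by_cases h : q.1 ∈ Icc (-R) R
        · exact hB0 _ (fun h' => hq ⟨h, h'⟩) _ _
        · exact hR _ 0 (by simpa using h) x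
      have hint : Integrable fun q : ℝ × (Fin k → ℝ) => G (Fin.cons q.1 q.2) x :=
        (hcont.comp (hcons.continuous.comp continuous_swap)).integrable_of_hasCompactSupport hcpt
      have he := (volume_preserving_piFinSuccAbove (fun _ : Fin (k + 1) => ℝ) 0).symm
      rw [hf, ← he.integral_comp']
      refine (integral_congr_ae (.of_forall fun q => ?_)).trans ((integral_prod _ hint).trans ?_)
      · simp [MeasurableEquiv.piFinSuccAbove, Fin.insertNthEquiv]
      · refine integral_congr_ae (.of_forall fun s => ?_)
        exact (setIntegral_eq_integral_of_forall_compl_eq_zero fun z hz => hB0 z hz s x).symm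

end Averages

/-! ### Operations on smooth families -/

section FamilyOperations

variable {d : ℕ} {M : Type*} [TopologicalSpace M] [ChartedSpace (Coord d) M] {n m : ℕ}
  {P Z : Type*} [NormedAddCommGroup P] [NormedSpace ℝ P] [NormedAddCommGroup Z] [NormedSpace ℝ Z]

theorem SmoothFamily.mul {G H : P → (Fin n → M) → ℂ} (hG : SmoothFamily d G)
    (hH : SmoothFamily d H) : SmoothFamily d fun p x => G p x * H p x :=
  fun q => contMDiffAt_mul_complex (hG q) (hH q)

theorem SmoothFamily.of_contDiff {ψ : P → ℝ} (hψ : ContDiff ℝ ∞ ψ) :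
    SmoothFamily d fun p (_ : Fin n → M) => (ψ p : ℂ) :=
  (Complex.ofRealCLM.contDiff.comp hψ).contMDiff.comp contMDiff_fst

theorem SmoothFamily.reindex {G : P → (Fin m → M) → ℂ} (hG : SmoothFamily d G)
    (σ : Fin m → Fin n) : SmoothFamily d fun p (x : Fin n → M) => G p (x ∘ σ) :=
  ContMDiff.comp (g := Function.uncurry G) (f := fun q : P × (Fin n → M) => (q.1, q.2 ∘ σ)) hG
    (contMDiff_fst.prodMk ((contMDiff_reindex σ).comp contMDiff_snd))

theorem contMDiffAt_pow {E H N : Type*} [NormedAddCommGroup E] [NormedSpace ℝ E]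
    [TopologicalSpace H] {I : ModelWithCorners ℝ E H} [TopologicalSpace N] [ChartedSpace H N]
    {f : N → Fin n → M} {y : N} (hf : ∀ i, ContMDiffAt I (𝓡 d) ∞ (fun y => f y i) y) :
    ContMDiffAt I (powModel d n) ∞ f y :=
  contMDiffAt_iff_target.2 ⟨continuousAt_pi.2 fun i => (hf i).continuousAt,
    contMDiffAt_pi_space.2 fun i => (contMDiffAt_iff_target.1 (hf i)).2⟩

/-- A smooth family may be evaluated at the coordinates of one of the points, once it is multiplied by
a cut-off supported in the domain of the chart. -/
theorem SmoothFamily.cutoff [IsManifold (𝓡 d) ∞ M] {e : OpenPartialHomeomorph M (Coord d)}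
    (he : e ∈ IsManifold.maximalAtlas (𝓡 d) ∞ M) (L : Coord d →L[ℝ] Z)
    {θ : M → ℝ} (hθ : ContMDiff (𝓡 d) 𝓘(ℝ, ℝ) ∞ θ) (hs : tsupport θ ⊆ e.source)
    {B : P × Z → (Fin n → M) → ℂ} (hB : SmoothFamily d B) (i : Fin n) :
    SmoothFamily d fun p x => (θ (x i) : ℂ) * B (p, L (e (x i))) x := by
  rintro ⟨p, x⟩
  have hi : ContMDiff (𝓘(ℝ, P).prod (powModel d n)) (𝓡 d) ∞ fun q : P × (Fin n → M) => q.2 i :=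
    (contMDiff_eval i).comp contMDiff_snd
  by_cases hx : x i ∈ e.source
  · refine contMDiffAt_mul_complex ?_ ?_
    · exact (Complex.ofRealCLM.contDiff.comp_contMDiff (hθ.comp hi)) (p, x)
    · have h1 : ContMDiffAt (𝓘(ℝ, P).prod (powModel d n)) 𝓘(ℝ, Coord d) ∞
          (fun q : P × (Fin n → M) => e (q.2 i)) (p, x) :=
        ContMDiffAt.comp (I' := 𝓡 d) (g := e) (f := fun q : P × (Fin n → M) => q.2 i) (p, x)
          (contMDiffAt_of_mem_maximalAtlas he hx) (hi (p, x))
      have h2 : ContMDiffAt (𝓘(ℝ, P).prod (powModel d n)) 𝓘(ℝ, P × Z) ∞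
          (fun q : P × (Fin n → M) => (q.1, L (e (q.2 i)))) (p, x) :=
        contMDiffAt_fst.prodMk_space (L.contDiff.contDiffAt.comp_contMDiffAt h1)
      exact ContMDiffAt.comp (I' := 𝓘(ℝ, P × Z).prod (powModel d n)) (g := Function.uncurry B)
        (f := fun q : P × (Fin n → M) => ((q.1, L (e (q.2 i))), q.2)) (p, x) (hB _)
        (h2.prodMk contMDiffAt_snd)
  · have h1 : ∀ᶠ q : P × (Fin n → M) in 𝓝 (p, x), q.2 i ∈ (tsupport θ)ᶜ :=
      hi.continuous.continuousAt.eventually_mem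
        ((isClosed_tsupport θ).isOpen_compl.mem_nhds fun h => hx (hs h))
    refine (contMDiffAt_const (c := (0 : ℂ))).congr_of_eventuallyEq ?_
    filter_upwards [h1] with q hq
    simp [Function.uncurry, image_eq_zero_of_notMem_tsupport hq]

end FamilyOperations

/-! ### Density of tensor products of test functions -/

section Density

open MeasureTheory

variable {d : ℕ} {M : Type*} [TopologicalSpace M] [ChartedSpace (Coord d) M]

/-- The function `F` on `M²` with its first argument read in the coordinates `L ∘ e`, extended by
zero. -/
noncomputable def localRep (e : OpenPartialHomeomorph M (Coord d)) (L : Coord d ≃L[ℝ] (Fin d → ℝ))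
    (F : TestFn d M 2) (s : Fin d → ℝ) (y : Fin 1 → M) : ℂ :=
  open scoped Classical in if L.symm s ∈ e.target then F ![e.symm (L.symm s), y 0] else 0

theorem localRep_apply {e : OpenPartialHomeomorph M (Coord d)} {L : Coord d ≃L[ℝ] (Fin d → ℝ)}
    {F : TestFn d M 2} {x : Fin 2 → M} (hx : x 0 ∈ e.source) :
    localRep e L F (L (e (x 0))) (x ∘ Fin.natAdd 1) = F x := by
  have h : ![x 0, x 1] = x := by ext i; fin_cases i <;> rfl
  simp only [localRep, L.symm_apply_apply, e.map_source hx, if_true, e.left_inv hx]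
  exact congrArg F h

theorem localRep_eq_zero {e : OpenPartialHomeomorph M (Coord d)} {L : Coord d ≃L[ℝ] (Fin d → ℝ)}
    {F : TestFn d M 2} {C : Set M} (hF : ∀ x, F x ≠ 0 → x 0 ∈ C)
    {s : Fin d → ℝ} (hs : s ∉ (fun x => L (e x)) '' C) (y : Fin 1 → M) : localRep e L F s y = 0 := by
  unfold localRep
  split_ifs with h
  · by_contra h1
    exact hs ⟨_, hF _ h1, by simp [e.right_inv h]⟩
  · rfl

theorem smoothFamily_localRep [T2Space M] [IsManifold (𝓡 d) ∞ M]
    {e : OpenPartialHomeomorph M (Coord d)}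
    (he : e ∈ IsManifold.maximalAtlas (𝓡 d) ∞ M) (L : Coord d ≃L[ℝ] (Fin d → ℝ))
    {F : TestFn d M 2} {C : Set M} (hC : IsCompact C) (hCe : C ⊆ e.source)
    (hF : ∀ x, F x ≠ 0 → x 0 ∈ C) : SmoothFamily d (localRep e L F) := by
  rintro ⟨s, y⟩
  have hC' : IsClosed ((fun x => L (e x)) '' C) :=
    (hC.image_of_continuousOn
      (L.continuous.comp_continuousOn (e.continuousOn.mono hCe))).isClosed
  by_cases hs : L.symm s ∈ e.target
  · have h1 : ContMDiffAt (𝓘(ℝ, Fin d → ℝ).prod (powModel d 1)) (powModel d 2) ∞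
        (fun q : (Fin d → ℝ) × (Fin 1 → M) => ![e.symm (L.symm q.1), q.2 0]) (s, y) := by
      refine contMDiffAt_pow fun i => ?_
      fin_cases i
      · have h2 : ContMDiffAt (𝓘(ℝ, Fin d → ℝ).prod (powModel d 1)) 𝓘(ℝ, Coord d) ∞
            (fun q : (Fin d → ℝ) × (Fin 1 → M) => L.symm q.1) (s, y) :=
          L.symm.contDiff.contDiffAt.comp_contMDiffAt contMDiffAt_fst
        exact ContMDiffAt.comp (I' := 𝓡 d) (g := e.symm)
          (f := fun q : (Fin d → ℝ) × (Fin 1 → M) => L.symm q.1) (s, y)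
          (contMDiffAt_symm_of_mem_maximalAtlas he hs) h2
      · exact ((contMDiff_eval 0).comp contMDiff_snd) (s, y)
    have h3 := ContMDiffAt.comp (I' := powModel d 2) (g := F) (s, y) (F.contMDiff _) h1
    refine h3.congr_of_eventuallyEq ?_
    have h4 : ∀ᶠ q : (Fin d → ℝ) × (Fin 1 → M) in 𝓝 (s, y), L.symm q.1 ∈ e.target :=
      (L.symm.continuous.comp continuous_fst).continuousAt.eventually_mem
        (e.open_target.mem_nhds hs)
    filter_upwards [h4] with q hq
    simp [Function.uncurry, localRep, hq]
  · have h1 : s ∉ (fun x => L (e x)) '' C := by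
      rintro ⟨x, hx, rfl⟩
      exact hs (by simpa using e.map_source (hCe hx))
    have h2 : ∀ᶠ q : (Fin d → ℝ) × (Fin 1 → M) in 𝓝 (s, y), q.1 ∈ ((fun x => L (e x)) '' C)ᶜ :=
      continuous_fst.continuousAt.eventually_mem (hC'.isOpen_compl.mem_nhds h1)
    refine (contMDiffAt_const (c := (0 : ℂ))).congr_of_eventuallyEq ?_
    filter_upwards [h2] with q hq
    exact localRep_eq_zero hF hq q.2

variable [T2Space M] [SecondCountableTopology M] [IsManifold (𝓡 d) ∞ M]

/-- A distribution on `M²` that vanishes on tensor products vanishes on the test functions `F` whose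
first argument stays in a coordinate patch: mollify `F` in that argument. For each `t ≠ 0` the
mollified function is an integral of tensor products, and it depends smoothly on `t`, including
`t = 0`, where it is `F`. -/
theorem DistributionOn.apply_eq_zero_of_chart {u : DistributionOn d M 2}
    (hu : ∀ f h : TestFn d M 1, u (f.tensor h) = 0)
    {e : OpenPartialHomeomorph M (Coord d)} (he : e ∈ IsManifold.maximalAtlas (𝓡 d) ∞ M)
    {F : TestFn d M 2} {C : Set M} (hC : IsCompact C) (hCe : C ⊆ e.source)
    (hF : ∀ x, F x ≠ 0 → x 0 ∈ C) : u F = 0 := by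
  have : LocallyCompactSpace M := ChartedSpace.locallyCompactSpace (Coord d) M
  obtain ⟨C', hC', hCC', hC'e⟩ := exists_compact_between hC e.open_source hCe
  obtain ⟨θ, hθ1, hθ0, -⟩ := exists_contMDiffMap_one_nhds_of_subset_interior (n := ⊤) (𝓡 d)
    hC.isClosed hCC'
  have hθC : tsupport θ ⊆ C' :=
    closure_minimal (fun x hx => by_contra fun h => hx (hθ0 x h)) hC'.isClosed
  have hθs : tsupport θ ⊆ e.source := hθC.trans hC'e
  have hθ : ContMDiff (𝓡 d) 𝓘(ℝ, ℝ) ∞ θ := θ.contMDiff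
  let L : Coord d ≃L[ℝ] (Fin d → ℝ) := EuclideanSpace.equiv (Fin d) ℝ
  let H := localRep e L F
  have hH : SmoothFamily d H := smoothFamily_localRep he L hC hCe hF
  let κ : ContDiffBump (0 : Fin d → ℝ) := ⟨1, 2, one_pos, one_lt_two⟩
  let ψ := κ.normed volume
  have hψ : ContDiff ℝ ∞ ψ := κ.contDiff_normed
  have hψ0 : ∀ s ∉ Metric.closedBall (0 : Fin d → ℝ) 2, ψ s = 0 := fun s hs => by
    have h := κ.tsupport_normed_eq (μ := volume)
    exact image_eq_zero_of_notMem_tsupport (by rw [h]; exact hs)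
  -- the compact set that contains all supports
  let K₂ : Set (Fin 1 → M) := (fun x : Fin 2 → M => x ∘ Fin.natAdd 1) '' tsupport F
  have hK₂ : IsCompact K₂ := F.hasCompactSupport.isCompact.image
    (continuous_pi fun i => continuous_apply _)
  have hHK : ∀ s, ∀ y ∉ K₂, H s y = 0 := fun s y hy => by
    by_contra h
    simp only [H, localRep] at h
    split_ifs at h with hs
    · refine hy ⟨_, subset_tsupport _ h, ?_⟩
      ext i
      fin_cases i
      rfl
    · exact h rfl
  let K₁ : Set (Fin 1 → M) := (fun (x : M) _ => x) '' C'
  have hK₁ : IsCompact K₁ := hC'.image (continuous_pi fun i => continuous_id)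
  let K : Set (Fin 2 → M) := (fun q : (Fin 1 → M) × (Fin 1 → M) => Fin.append q.1 q.2) '' K₁ ×ˢ K₂
  have hK : IsCompact K := (hK₁.prod hK₂).image (Fin.continuous_append 1 1)
  have hKmem : ∀ x ∉ K, θ (x 0) = 0 ∨ ∀ s, H s (x ∘ Fin.natAdd 1) = 0 := fun x hx => by
    by_contra! h
    obtain ⟨h1, s, h2⟩ := h
    refine hx ⟨(x ∘ Fin.castAdd 1, x ∘ Fin.natAdd 1), ⟨⟨x 0, ?_, ?_⟩, ?_⟩, ?_⟩
    · exact by_contra fun h => h1 (hθ0 _ h)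
    · ext i
      fin_cases i
      rfl
    · exact by_contra fun h => h2 (hHK s _ h)
    · exact Fin.append_castAdd_natAdd
  -- `T t` mollifies `F` at scale `t` in its first argument; since the scale multiplies the integration
  -- variable, the family is smooth at `t = 0` too
  let T : ℝ → (Fin 2 → M) → ℂ := fun t x => (θ (x 0) : ℂ) *
    ∫ s in Metric.closedBall (0 : Fin d → ℝ) 2, ψ s * H (L (e (x 0)) + t • s) (x ∘ Fin.natAdd 1)
  have hT : SmoothFamily d T := by
    have h1 : SmoothFamily d fun (q : (Fin d → ℝ) × (ℝ × (Fin d → ℝ))) (x : Fin 2 → M) =>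
        (ψ q.1 : ℂ) * H (q.2.2 + q.2.1 • q.1) (x ∘ Fin.natAdd 1) :=
      (SmoothFamily.of_contDiff (hψ.comp contDiff_fst)).mul
        ((hH.comp (contDiff_snd.snd.add (contDiff_snd.fst.smul contDiff_fst))).reindex
          (Fin.natAdd 1))
    exact SmoothFamily.cutoff he (L : Coord d →L[ℝ] (Fin d → ℝ)) hθ hθs
      (h1.setIntegral (μ := volume) (isCompact_closedBall (0 : Fin d → ℝ) 2)) 0
  have hTK : ∀ t, ∀ x ∉ K, T t x = 0 := fun t x hx => by
    rcases hKmem x hx with h | h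
    · simp [T, h]
    · simp [T, h]
  have hzero : ∀ t ∈ ({0} : Set ℝ)ᶜ, u (hT.testFn hK hTK t) = 0 := by
    intro t ht
    have ht : t ≠ 0 := ht
    -- the tensor products of which the mollified function is the integral
    have ha : SmoothFamily d fun (z : Fin d → ℝ) (x : Fin 1 → M) =>
        (θ (x 0) : ℂ) * (ψ (t⁻¹ • (z - L (e (x 0)))) : ℂ) :=
      SmoothFamily.cutoff he (L : Coord d →L[ℝ] (Fin d → ℝ)) hθ hθs
        (SmoothFamily.of_contDiff (P := (Fin d → ℝ) × (Fin d → ℝ))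
          (hψ.comp ((contDiff_fst.sub contDiff_snd).const_smul t⁻¹))) 0
    have haK : ∀ z : Fin d → ℝ, ∀ x ∉ K₁,
        (θ (x 0) : ℂ) * (ψ (t⁻¹ • (z - L (e (x 0)))) : ℂ) = 0 := fun z x hx => by
      rw [hθ0 (x 0) fun h => hx ⟨x 0, h, funext fun i => congrArg x (Subsingleton.elim _ _)⟩]
      simp
    let G : (Fin d → ℝ) → (Fin 2 → M) → ℂ := fun z x =>
      (θ (x 0) : ℂ) * (ψ (t⁻¹ • (z - L (e (x 0)))) : ℂ) * H z (x ∘ Fin.natAdd 1)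
    have hG : SmoothFamily d G := (ha.reindex (Fin.castAdd 1)).mul (hH.reindex (Fin.natAdd 1))
    have hGK : ∀ z, ∀ x ∉ K, G z x = 0 := fun z x hx => by
      rcases hKmem x hx with h | h
      · simp [G, h]
      · simp [G, h]
    have hGu : ∀ z, u (hG.testFn hK hGK z) = 0 := fun z => by
      have : hG.testFn hK hGK z = (ha.testFn hK₁ haK z).tensor (hH.testFn hK₂ hHK z) :=
        TestFn.ext fun x => rfl
      rw [this, hu]
    have hbd : IsCompact ((fun x => L (e x)) '' C) := hC.image_of_continuousOn
      (L.continuous.comp_continuousOn (e.continuousOn.mono hCe))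
    obtain ⟨R, hR⟩ := hbd.isBounded.subset_closedBall 0
    have hGR : ∀ z : Fin d → ℝ, ∀ i, z i ∉ Icc (-R) R → ∀ x, G z x = 0 := fun z i hz x => by
      have : z ∉ (fun x => L (e x)) '' C := fun h => by
        have h1 := (norm_le_pi_norm z i).trans (mem_closedBall_zero_iff.1 (hR h))
        exact hz (abs_le.1 h1)
      simp [G, H, localRep_eq_zero hF this]
    -- `|t ^ d|` is the Jacobian of the substitution `z = L (e (x 0)) + t • s`
    have key : u (((|t ^ d| : ℝ) : ℂ) • hT.testFn hK hTK t) = 0 := by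
      refine u.apply_integral_eq_zero hG hK hGK hGR hGu _ fun x => ?_
      change ((|t ^ d| : ℝ) : ℂ) * T t x = _
      let g : (Fin d → ℝ) → ℂ := fun z =>
        (ψ (t⁻¹ • (z - L (e (x 0)))) : ℂ) * H z (x ∘ Fin.natAdd 1)
      have h1 : ∫ s in Metric.closedBall (0 : Fin d → ℝ) 2,
          (ψ s : ℂ) * H (L (e (x 0)) + t • s) (x ∘ Fin.natAdd 1) =
          ∫ s, g (L (e (x 0)) + t • s) := by
        rw [setIntegral_eq_integral_of_forall_compl_eq_zero fun s hs => by simp [hψ0 s hs]]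
        refine integral_congr_ae (.of_forall fun s => ?_)
        simp [g, smul_smul, inv_mul_cancel₀ ht]
      have h2 := Measure.integral_comp_smul (volume : Measure (Fin d → ℝ))
        (fun z => g (L (e (x 0)) + z)) t
      rw [integral_add_left_eq_self g, Module.finrank_fin_fun] at h2
      have h3 : ∀ z, G z x = (θ (x 0) : ℂ) * g z := fun z => mul_assoc _ _ _
      simp only [h3]
      rw [integral_const_mul]
      change _ * ((θ (x 0) : ℂ) * _) = _
      rw [h1, h2, abs_inv, Complex.real_smul, mul_left_comm, ← mul_assoc ((|t ^ d| : ℝ) : ℂ),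
        ← Complex.ofReal_mul, mul_inv_cancel₀ (abs_ne_zero.2 (pow_ne_zero d ht)),
        Complex.ofReal_one, one_mul]
    rw [map_smul, smul_eq_zero] at key
    refine key.resolve_left ?_
    exact_mod_cast abs_ne_zero.2 (pow_ne_zero d ht)
  have hcont : Continuous fun t => u (hT.testFn hK hTK t) :=
    u.continuous.comp (hT.continuous_testFn hK hTK)
  have hall := hcont.ext_on (dense_compl_singleton (0 : ℝ)) continuous_const hzero
  have hT0 : hT.testFn hK hTK 0 = F := by
    ext x
    change T 0 x = F x
    have h1 : ∫ s in Metric.closedBall (0 : Fin d → ℝ) 2, (ψ s : ℂ) = 1 := by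
      rw [setIntegral_eq_integral_of_forall_compl_eq_zero fun s hs => by simp [hψ0 s hs],
        integral_complex_ofReal, κ.integral_normed, Complex.ofReal_one]
    simp only [T, zero_smul, add_zero]
    rw [integral_mul_const, h1, one_mul]
    by_cases hx : x 0 ∈ e.source
    · rw [show H (L (e (x 0))) (x ∘ Fin.natAdd 1) = F x from localRep_apply hx]
      by_cases h0 : F x = 0
      · rw [h0, mul_zero]
      · rw [hθ1.self_of_nhdsSet _ (hF x h0), Complex.ofReal_one, one_mul]
    · rw [image_eq_zero_of_notMem_tsupport fun h => hx (hθs h), Complex.ofReal_zero, zero_mul]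
      by_contra h0
      exact hx (hCe (hF x (Ne.symm h0)))
  rw [← hT0]
  exact congrFun hall 0

/-- Tensor products are total in `C^∞_0(M²)`: a distribution on `M²` is determined by its values on
them. -/
theorem DistributionOn.eq_zero_of_tensor {u : DistributionOn d M 2}
    (hu : ∀ f h : TestFn d M 1, u (f.tensor h) = 0) : u = 0 := by
  ext F
  have : LocallyCompactSpace M := ChartedSpace.locallyCompactSpace (Coord d) M
  let K : Set M := (fun x : Fin 2 → M => x 0) '' tsupport F
  have hK : IsCompact K := F.hasCompactSupport.isCompact.image (continuous_apply 0)
  obtain ⟨ρ, hρ⟩ := SmoothPartitionOfUnity.exists_isSubordinate_chartAt_source (𝓡 d) M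
  have hfin := ρ.locallyFinite.finite_nonempty_inter_compact hK
  let F' : M → TestFn d M 2 := fun i => .mk (fun x => (ρ i (x 0) : ℂ) * F x)
    (fun x => contMDiffAt_mul_complex
      (Complex.ofRealCLM.contDiff.comp_contMDiff ((ρ i).contMDiff.comp (contMDiff_eval 0)) x)
      (F.contMDiff x))
    F.hasCompactSupport.mul_left
  have hsum : F = ∑ i ∈ hfin.toFinset, F' i := by
    ext x
    let ev : TestFn d M 2 →+ ℂ := ⟨⟨fun f => f x, rfl⟩, fun _ _ => rfl⟩
    change F x = ev (∑ i ∈ hfin.toFinset, F' i)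
    rw [map_sum]
    change F x = ∑ i ∈ hfin.toFinset, (ρ i (x 0) : ℂ) * F x
    rw [← Finset.sum_mul]
    by_cases hx : F x = 0
    · simp [hx]
    · have hxK : x 0 ∈ K := ⟨x, subset_tsupport _ hx, rfl⟩
      have h1 := ρ.sum_eq_one (mem_univ (x 0))
      rw [finsum_eq_sum_of_support_subset (s := hfin.toFinset) _ fun i hi => by
        simpa using ⟨x 0, hi, hxK⟩] at h1
      rw [← Complex.ofReal_sum, h1, Complex.ofReal_one, one_mul]
  rw [hsum, map_sum]
  refine Finset.sum_eq_zero fun i _ => ?_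
  refine DistributionOn.apply_eq_zero_of_chart hu
    (IsManifold.chart_mem_maximalAtlas i) (C := tsupport (ρ i) ∩ K)
    (hK.inter_left (isClosed_tsupport _)) (inter_subset_left.trans (hρ i)) fun x hx => ⟨?_, ?_⟩
  · refine subset_tsupport _ fun h => hx ?_
    change (ρ i (x 0) : ℂ) * F x = 0
    rw [h, Complex.ofReal_zero, zero_mul]
  · exact ⟨x, subset_tsupport _ (right_ne_zero_of_mul hx), rfl⟩

end Density

/-! ### The commutator of a generalised free field -/

theorem QuantumState.IsGeneralisedFreeField.commutator_eq {d : ℕ} {M : Type*} [TopologicalSpace M]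
    [T2Space M] [SecondCountableTopology M] [ChartedSpace (Coord d) M] [IsManifold (𝓡 d) ∞ M]
    {w : QuantumState d M} {E : DistributionOn d M 2} (hE : w.IsGeneralisedFreeField E) :
    E = (-2 * Complex.I) • w.twoPointAntisym := by
  rw [← sub_eq_zero]
  refine DistributionOn.eq_zero_of_tensor fun f h => ?_
  have h1 := hE _ (Submodule.mem_sInf.2 fun J hJ => hJ.2 f h)
  have h2 : smearedField f * smearedField h = BorchersUhlmann.incl 2 (f.tensor h) :=
    DirectSum.of_mul_of f h
  have h3 : smearedField h * smearedField f =
      BorchersUhlmann.incl 2 (TestFn.permute Fin.revPerm (f.tensor h)) := by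
    refine (DirectSum.of_mul_of h f).trans (congrArg (DirectSum.of (TestFn d M) 2) ?_)
    ext x
    refine (mul_comm _ _).trans (congrArg₂ (· * ·) (congrArg f ?_) (congrArg h ?_)) <;>
    · ext i
      fin_cases i
      rfl
  rw [map_sub, map_sub, map_smul, w.normalised, smul_eq_mul, mul_one, h2, h3] at h1
  change w.nPoint 2 (f.tensor h) - (w.nPoint 2).permute Fin.revPerm (f.tensor h) -
    Complex.I * E (f.tensor h) = 0 at h1
  change E (f.tensor h) - (-2 * Complex.I) * ((1 / 2 : ℂ) * (w.nPoint 2 (f.tensor h) -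
    (w.nPoint 2).permute Fin.revPerm (f.tensor h))) = 0
  linear_combination Complex.I * h1 + E (f.tensor h) * Complex.I_mul_I

/-! ### The two-point distribution of a generalised Hadamard state -/

section Hadamard

variable {d : ℕ} {M : Type*} [TopologicalSpace M] [ChartedSpace (Coord d) M]

theorem comp_rev_comp_rev (p : Fin 2 → Covector d M) : (p ∘ Fin.rev) ∘ Fin.rev = p := by
  funext i
  simp

/-- The symmetries of a distribution that is an eigenvector of the exchange of its arguments and real up
to a phase. -/
theorem wavefrontSet_symmetric {u : DistributionOn d M 2} {c : ℂ} (hc : c ≠ 0)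
    (hrev : u.permute Fin.revPerm = c • u) (hconj : ∀ f : TestFn d M 2, ‖u f.conj‖ = ‖u f‖)
    (p : Fin 2 → Covector d M) :
    (p ∈ wavefrontSet u ↔ p ∘ Fin.rev ∈ wavefrontSet u) ∧
      (p ∈ wavefrontSet u ↔ negCovectors p ∈ wavefrontSet u) := by
  have h1 : ∀ q ∈ wavefrontSet u, q ∘ Fin.rev ∈ wavefrontSet u := fun q hq => by
    rw [← wavefrontSet_smul hc, ← hrev] at hq
    exact wavefrontSet_permute_subset _ _ hq
  refine ⟨⟨h1 p, fun h => ?_⟩, ⟨negCovectors_mem_wavefrontSet hconj, fun h => ?_⟩⟩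
  · simpa only [comp_rev_comp_rev] using h1 _ h
  · simpa only [negCovectors_negCovectors] using negCovectors_mem_wavefrontSet hconj h

variable [T2Space M]

theorem QuantumState.twoPointSym_add_twoPointAntisym (w : QuantumState d M) :
    w.twoPointSym + w.twoPointAntisym = w.nPoint 2 := by
  rw [twoPointSym, twoPointAntisym]
  module

theorem QuantumState.twoPointSym_sub_twoPointAntisym (w : QuantumState d M) :
    w.twoPointSym + (-1 : ℂ) • w.twoPointAntisym = (w.nPoint 2).permute Fin.revPerm := by
  rw [twoPointSym, twoPointAntisym]
  module

variable [IsManifold (𝓡 d) ∞ M] {S : Spacetime d M} {w : QuantumState d M}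

theorem QuantumState.IsGeneralisedHadamard.wavefrontSet_permute_subset
    (hw : w.IsGeneralisedHadamard S) :
    wavefrontSet ((w.nPoint 2).permute Fin.revPerm) ⊆ negGammaSet S 2 := fun p hp => by
  have h := negCovectors_rev_mem_gammaSet (hw (QFT.wavefrontSet_permute_subset _ _ hp))
  change negCovectors ((p ∘ Fin.rev) ∘ Fin.rev) ∈ GammaSet S 2 at h
  rwa [comp_rev_comp_rev] at h

theorem QuantumState.IsGeneralisedHadamard.wavefrontSet_twoPointAntisym_subset
    (hw : w.IsGeneralisedHadamard S) :
    wavefrontSet w.twoPointAntisym ⊆ GammaSet S 2 ∪ negGammaSet S 2 := by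
  have h : w.twoPointAntisym =
      (1 / 2 : ℂ) • (w.nPoint 2 + (-1 : ℂ) • (w.nPoint 2).permute Fin.revPerm) := by
    rw [twoPointAntisym]
    module
  rw [h]
  exact (wavefrontSet_smul_subset _ _).trans ((wavefrontSet_add_subset _ _).trans
    (union_subset_union hw ((wavefrontSet_smul_subset _ _).trans hw.wavefrontSet_permute_subset)))

theorem QuantumState.IsGeneralisedHadamard.wavefrontSet_twoPointSym_subset
    (hw : w.IsGeneralisedHadamard S) :
    wavefrontSet w.twoPointSym ⊆ GammaSet S 2 ∪ negGammaSet S 2 :=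
  (wavefrontSet_smul_subset _ _).trans ((wavefrontSet_add_subset _ _).trans
    (union_subset_union hw hw.wavefrontSet_permute_subset))

/-- Over `Γ₂` the permuted two-point distribution is microlocally negligible and over `-Γ₂` the
two-point distribution itself is, so that `ω₂₊ = ± ω₂₋` there up to negligible terms. -/
theorem QuantumState.IsGeneralisedHadamard.wavefrontSet_twoPointSym_eq
    (hw : w.IsGeneralisedHadamard S) :
    wavefrontSet w.twoPointSym = wavefrontSet w.twoPointAntisym := by
  have hd := Set.disjoint_left.1 (disjoint_gammaSet_negGammaSet (S := S))
  have h1 := w.twoPointSym_add_twoPointAntisym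
  have h2 := w.twoPointSym_sub_twoPointAntisym
  refine Subset.antisymm (fun p hp => ?_) (fun p hp => ?_)
  · rcases hw.wavefrontSet_twoPointSym_subset hp with hG | hG
    · have e : w.twoPointSym = (w.nPoint 2).permute Fin.revPerm + w.twoPointAntisym := by
        rw [← h2]; module
      rw [e] at hp
      exact (wavefrontSet_add_subset _ _ hp).resolve_left fun h =>
        hd hG (hw.wavefrontSet_permute_subset h)
    · have e : w.twoPointSym = w.nPoint 2 + (-1 : ℂ) • w.twoPointAntisym := by
        rw [← h1]; module
      rw [e] at hp
      exact wavefrontSet_smul_subset _ _ ((wavefrontSet_add_subset _ _ hp).resolve_left fun h =>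
        hd (hw h) hG)
  · rcases hw.wavefrontSet_twoPointAntisym_subset hp with hG | hG
    · have e : w.twoPointAntisym =
          (-1 : ℂ) • (w.nPoint 2).permute Fin.revPerm + w.twoPointSym := by
        rw [← h2]; module
      rw [e] at hp
      exact (wavefrontSet_add_subset _ _ hp).resolve_left fun h =>
        hd hG (hw.wavefrontSet_permute_subset (wavefrontSet_smul_subset _ _ h))
    · have e : w.twoPointAntisym = w.nPoint 2 + (-1 : ℂ) • w.twoPointSym := by
        rw [← h1]; module
      rw [e] at hp
      exact wavefrontSet_smul_subset _ _ ((wavefrontSet_add_subset _ _ hp).resolve_left fun h =>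
        hd (hw h) hG)

theorem QuantumState.IsGeneralisedHadamard.wavefrontSet_nPoint_two
    (hw : w.IsGeneralisedHadamard S) :
    wavefrontSet (w.nPoint 2) = wavefrontSet w.twoPointAntisym ∩ GammaSet S 2 := by
  have hd := Set.disjoint_left.1 (disjoint_gammaSet_negGammaSet (S := S))
  refine Subset.antisymm (fun p hp => ⟨?_, hw hp⟩) ?_
  · rw [← w.twoPointSym_add_twoPointAntisym] at hp
    rcases wavefrontSet_add_subset _ _ hp with h | h
    · rwa [hw.wavefrontSet_twoPointSym_eq] at h
    · exact h
  · rintro p ⟨hp, hG⟩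
    have e : w.twoPointAntisym =
        (1 / 2 : ℂ) • (w.nPoint 2 + (-1 : ℂ) • (w.nPoint 2).permute Fin.revPerm) := by
      rw [twoPointAntisym]
      module
    rw [e] at hp
    exact (wavefrontSet_add_subset _ _ (wavefrontSet_smul_subset _ _ hp)).resolve_right fun h =>
      hd hG (hw.wavefrontSet_permute_subset (wavefrontSet_smul_subset _ _ h))

end Hadamard

end QFT

theorem mainTheorem9 {d : ℕ} (hd : 2 ≤ d) {M : Type*} [TopologicalSpace M] [T2Space M]
    [SecondCountableTopology M] [ConnectedSpace M] [ChartedSpace (EuclideanSpace ℝ (Fin d)) M]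
    [IsManifold (𝓡 d) ∞ M] (S : Spacetime d M) (w : QuantumState d M)
    (hw : w.IsGeneralisedHadamard S) :
    (∀ p : Fin 2 → Covector d M,
      ((p ∈ wavefrontSet w.twoPointSym ↔ p ∘ Fin.rev ∈ wavefrontSet w.twoPointSym) ∧
        (p ∈ wavefrontSet w.twoPointSym ↔ negCovectors p ∈ wavefrontSet w.twoPointSym)) ∧
      ((p ∈ wavefrontSet w.twoPointAntisym ↔ p ∘ Fin.rev ∈ wavefrontSet w.twoPointAntisym) ∧
        (p ∈ wavefrontSet w.twoPointAntisym ↔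
          negCovectors p ∈ wavefrontSet w.twoPointAntisym))) ∧
    wavefrontSet w.twoPointSym = wavefrontSet w.twoPointAntisym ∧
    wavefrontSet w.twoPointAntisym ⊆ GammaSet S 2 ∪ negGammaSet S 2 ∧
    wavefrontSet (w.nPoint 2) = wavefrontSet w.twoPointAntisym ∩ GammaSet S 2 ∧
    ∀ E : DistributionOn d M 2, w.IsGeneralisedFreeField E →
      E = (-2 * Complex.I) • w.twoPointAntisym ∧
      wavefrontSet E ⊆ GammaSet S 2 ∪ negGammaSet S 2 ∧
      wavefrontSet (w.nPoint 2) = wavefrontSet E ∩ GammaSet S 2 := by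
  have hE : ∀ E : DistributionOn d M 2, w.IsGeneralisedFreeField E →
      wavefrontSet E = wavefrontSet w.twoPointAntisym := fun E hE => by
    rw [hE.commutator_eq, wavefrontSet_smul (by simp)]
  refine ⟨fun p => ⟨wavefrontSet_symmetric one_ne_zero ?_ w.norm_twoPointSym_conj p,
    wavefrontSet_symmetric (by simp) w.twoPointAntisym_permute w.norm_twoPointAntisym_conj p⟩,
    hw.wavefrontSet_twoPointSym_eq, hw.wavefrontSet_twoPointAntisym_subset,
    hw.wavefrontSet_nPoint_two, fun E h => ⟨h.commutator_eq, ?_, ?_⟩⟩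
  · rw [w.twoPointSym_permute, one_smul]
  · rw [hE E h]
    exact hw.wavefrontSet_twoPointAntisym_subset
  · rw [hE E h]
    exact hw.wavefrontSet_nPoint_two
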